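/- For an integer $t\ge -1$ put $f_t(x)=x^3-tx^2-(t+3)x-1$ and $\Delta_t=t^2+3t+9$, and write $K_t=\mathbb{Q}(\theta_t)$, where $\theta_t$ is a root of $f_t$. For a number field $K$ write $\mathcal{O}_K$ for its ring of integers, and for an abelian number field $K$ let its conductor $c_K$ be the smallest positive integer $n$ such that $K\subseteq\mathbb{Q}(\zeta_n)$. Let $K$ be a cyclic cubic field, i.e. a Galois extension of $\mathbb{Q}$ of degree $3$. The following are equivalent: (i) $K$ has a power integral basis, i.e. $\mathcal{O}_K=\mathbb{Z}[\gamma]$ for some $\gamma\in\mathcal{O}_K$; (ii) there is an integer $t\ge -1$ such that $K=K_t$ and $\Delta_t/c_K=n^3$ for some natural number $n$; (iii) there is an integer $t\ge -1$ such that $K=K_t$, $t\not\equiv 3,21 \pmod{27}$, and $v_p(\Delta_t)\not\equiv 2\pmod 3$ for every prime $p\ne 3$, where $v_p$ is the $p$-adic valuation. Moreover, let $t\ge -1$ be any integer with $K=K_t$ that satisfies the condition in (ii) or the condition in (iii), and let $\theta_t\in K$ be any root of $f_t$. Then $n:=\sqrt[3]{\Delta_t/c_K}$ is a positive integer, and $3\mid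 t$ if $3\mid n$. There is an integer $a$ such that $$a\equiv \tfrac{t}{3}\pmod n \ \text{ if } 3\mid n,\qquad 3a\equiv t\pmod n\ \text{ if } 3\nmid n,$$ and for every such $a$ the element $$\gamma=\frac{\theta_t-a}{n}$$ lies in $\mathcal{O}_K$ and satisfies $\mathcal{O}_K=\mathbb{Z}[\gamma]$. -/

import Mathlib

open Polynomial NumberField

/-- The Shanks cubic polynomial `X³ - t X² - (t + 3) X - 1`. -/
noncomputable def shanksPoly (t : ℤ) : ℤ[X] :=
  X ^ 3 - C t * X ^ 2 - C (t + 3) * X - 1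

/-- `Δ_t = t² + 3 t + 9`. -/
def shanksDelta (t : ℤ) : ℤ := t ^ 2 + 3 * t + 9

/-- `θ` is a root of the Shanks polynomial of parameter `t`, and `K = ℚ(θ)`. -/
def IsShanksGenerator {K : Type*} [Field K] [NumberField K] (t : ℤ) (θ : K) : Prop :=
  aeval θ (shanksPoly t) = 0 ∧ IntermediateField.adjoin ℚ {θ} = ⊤

/-- `K = K_t`: the field `K` is generated over `ℚ` by a root of the Shanks polynomial. -/
def IsSimplestCubic (K : Type*) [Field K] [NumberField K] (t : ℤ) : Prop :=
  ∃ θ : K, IsShanksGenerator t θ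

/-- The conductor of an abelian number field `K`: the smallest positive integer `n` such that
`K` embeds into the `n`-th cyclotomic field. -/
noncomputable def abelianConductor (K : Type*) [Field K] [NumberField K] : ℕ :=
  sInf {n : ℕ | 0 < n ∧ Nonempty (K →ₐ[ℚ] CyclotomicField n ℚ)}

/-- `𝓞 K = ℤ[γ]`. -/
def GeneratesIntegers {K : Type*} [Field K] [NumberField K] (γ : 𝓞 K) : Prop :=
  Algebra.adjoin ℤ {γ} = ⊤

/-- `K` has a power integral basis. -/
def HasPowerIntegralBasis (K : Type*) [Field K] [NumberField K] : Prop :=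
  ∃ γ : 𝓞 K, GeneratesIntegers γ

/-- `Δ_t / c_K` is the cube of the natural number `n`, written without division. -/
def DeltaQuotientIsCubeOf (K : Type*) [Field K] [NumberField K] (t : ℤ) (n : ℕ) : Prop :=
  shanksDelta t = (abelianConductor K : ℤ) * (n : ℤ) ^ 3

/-- `t ≢ 3, 21 mod 27` and `v_p(Δ_t) ≢ 2 mod 3` for all primes `p ≠ 3`. -/
def ShanksValuationCondition (t : ℤ) : Prop :=
  ¬ t ≡ 3 [ZMOD 27] ∧ ¬ t ≡ 21 [ZMOD 27] ∧
    ∀ p : ℕ, p.Prime → p ≠ 3 → ¬ padicValInt p (shanksDelta t) ≡ 2 [MOD 3]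

/-- The congruence `a ≡ t / 3 mod n`: if `3 ∣ n`, then `t / 3` is required to be an integer, to
which `a` is congruent; if `3 ∤ n`, it means `3 a ≡ t mod n`. -/
def CongruentToThird (t : ℤ) (n : ℕ) (a : ℤ) : Prop :=
  (3 ∣ n → ∃ s : ℤ, t = 3 * s ∧ a ≡ s [ZMOD n]) ∧ (¬ 3 ∣ n → 3 * a ≡ t [ZMOD n])

/-! Put `λ = t - 3ω` in `ℤ[ω]`, so that `N(λ) = Δ_t`. The element `y = 3θ_t - t` satisfies `y³ =
3Δ_t y + (2t+3)Δ_t`, and `4Δ_t = (2t+3)² + 27`. Most of the proof reads off arithmetic from these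
identities.

(iii) ⇒ (ii) is a computation of the conductor. By Cardano, `K_t` embeds in any field of
characteristic 0 that contains `ω` and in which `λ²λ̄` is a cube. For `p ≡ 1 mod 3` the cubic Jacobi
sum `J` has norm `p`, and `J²J̄` is the cube of a Gauss sum. Once its part at 3 is removed, `λ` is a
product of such `J` or `J̄`, a cube and a unit (`exists_cube_eq`). So `K_t` lies in the cyclotomic
field whose level is the product of the primes `p ≠ 3` with `v_p(Δ_t) ≡ 1 mod 3`, times 9 if `t ≡ 0,
6 mod 9`. These primes are all needed: when `p ∤ m` the ring of integers of `ℚ(ζ_m)` is reduced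
modulo `p` (`exists_eq_mul_of_pow_eq_mul`), which the cubic for `y`, or an Eisenstein shift at 3,
contradicts.

(ii) ⇒ (iii): Galois theory of cyclotomic fields shows that the conductor `c` of a cyclic cubic
field is squarefree away from 3 and not divisible by 27. Hence `v_p(Δ_t) ≡ v_p(c)` modulo 3 is never
2.

(iii) ⇒ (i): `γ = (θ_t - a)/n` is integral with discriminant `Δ_t²/n⁶ = c²`, so `c 𝓞 ⊆ ℤ[γ]`. For
each prime `p ∣ c` the order `ℤ[γ]` contains a root of a cubic that is Eisenstein at `p`, and it is
therefore maximal there (`exists_generatesIntegers`).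

(i) ⇒ (iii): if `𝓞 = ℤ[γ]` and `x, y, z` are the conjugates of `γ`, then `u = (y - z)/(x - y)` is a
unit and a root of some `f_t`. Its `Δ_t` equals `d n³` with `d = (x-y)(y-z)(z-x)`, and a square
factor of `d` away from 3, or a bad `t mod 27`, would produce integers outside `ℤ[γ]` or an
impossible congruence (`exists_shanks_of_generatesIntegers`). -/

/-- The ring `ℤ[ω]` of Eisenstein integers. -/
abbrev EisensteinInt : Type := QuadraticAlgebra ℤ (-1) (-1)

/-! ### Eisenstein integers: Euclidean division, units, primary elements -/

namespace EisensteinInt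

open QuadraticAlgebra

/-- The primitive third root of unity of `ℤ[ω]`. -/
abbrev w : EisensteinInt := QuadraticAlgebra.omega

lemma norm_eq (z : EisensteinInt) : norm z = z.re ^ 2 - z.re * z.im + z.im ^ 2 := by
  rw [norm_def]; ring

lemma mul_star_eq (z : EisensteinInt) : z * star z = ((norm z : ℤ) : EisensteinInt) := by
  rw [← algebraMap_norm_eq_mul_star]; simp

lemma norm_nonneg (z : EisensteinInt) : 0 ≤ norm z := by
  rw [norm_eq]; nlinarith [sq_nonneg (2 * z.re - z.im), sq_nonneg z.im]

lemma norm_eq_zero {z : EisensteinInt} : norm z = 0 ↔ z = 0 := by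
  constructor
  · intro h
    rw [norm_eq] at h
    have h1 : z.im = 0 := by
      have : z.im ^ 2 = 0 := by nlinarith [sq_nonneg (2 * z.re - z.im), sq_nonneg z.im]
      exact pow_eq_zero_iff (two_ne_zero) |>.1 this
    have h2 : z.re = 0 := by
      rw [h1] at h
      have : z.re ^ 2 = 0 := by linarith
      exact pow_eq_zero_iff (two_ne_zero) |>.1 this
    ext <;> simp [h1, h2]
  · rintro rfl; simp

instance : IsDomain EisensteinInt where
  mul_left_cancel_of_ne_zero := by
    intro a ha b c h
    have h1 : norm (a * (b - c)) = 0 := by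
      rw [mul_sub, sub_eq_zero.2 h]; simp
    rw [map_mul, mul_eq_zero, norm_eq_zero, norm_eq_zero] at h1
    exact sub_eq_zero.1 (h1.resolve_left ha)
  mul_right_cancel_of_ne_zero := by
    intro a ha b c h
    have h1 : norm ((b - c) * a) = 0 := by
      rw [sub_mul, sub_eq_zero.2 h]; simp
    rw [map_mul, mul_eq_zero, norm_eq_zero, norm_eq_zero] at h1
    exact sub_eq_zero.1 (h1.resolve_right ha)
  exists_pair_ne := ⟨0, 1, by intro h; simpa using congrArg QuadraticAlgebra.re h⟩

lemma exists_nearest (u N : ℤ) (hN : 0 < N) : ∃ q : ℤ, |2 * (u - q * N)| ≤ N := by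
  refine ⟨(2 * u + N) / (2 * N), ?_⟩
  have h1 := Int.emod_add_mul_ediv (2 * u + N) (2 * N)
  have h2 := Int.emod_nonneg (2 * u + N) (show 2 * N ≠ 0 by positivity)
  have h3 := Int.emod_lt_of_pos (2 * u + N) (show 0 < 2 * N by positivity)
  rw [abs_le]
  constructor <;> nlinarith

/-- Round both coordinates of `z v̄ / N(v)`: errors of at most 1/2 have norm `x² - xy + y² ≤ 3/4`.
-/
lemma exists_norm_sub_mul_lt (z v : EisensteinInt) (hv : v ≠ 0) :
    ∃ q : EisensteinInt, norm (z - v * q) < norm v := by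
  have hN : 0 < norm v := lt_of_le_of_ne (norm_nonneg v) (fun h => hv (norm_eq_zero.1 h.symm))
  obtain ⟨a, ha⟩ := exists_nearest (z * star v).re (norm v) hN
  obtain ⟨b, hb⟩ := exists_nearest (z * star v).im (norm v) hN
  refine ⟨⟨a, b⟩, ?_⟩
  have key : (z - v * ⟨a, b⟩) * star v =
      ⟨(z * star v).re - a * norm v, (z * star v).im - b * norm v⟩ := by
    have : (z - v * ⟨a, b⟩) * star v = z * star v - ⟨a, b⟩ * (v * star v) := by ring
    rw [this, mul_star_eq]
    ext <;> simp
  have h1 : norm (z - v * ⟨a, b⟩) * norm v =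
      norm (⟨(z * star v).re - a * norm v, (z * star v).im - b * norm v⟩ : EisensteinInt) := by
    rw [← key, map_mul, QuadraticAlgebra.norm_star]
  have h1 : norm (z - v * ⟨a, b⟩) * norm v =
      ((z * star v).re - a * norm v) ^ 2 - ((z * star v).re - a * norm v) *
        ((z * star v).im - b * norm v) + ((z * star v).im - b * norm v) ^ 2 := by
    rw [h1, norm_eq]
  set x := (z * star v).re - a * norm v
  set y := (z * star v).im - b * norm v
  rw [abs_le] at ha hb
  have h2 : 4 * (x ^ 2 - x * y + y ^ 2) ≤ 3 * norm v ^ 2 := by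
    nlinarith [mul_nonneg (sub_nonneg.2 ha.1) (sub_nonneg.2 ha.2), mul_nonneg (sub_nonneg.2 hb.1)
      (sub_nonneg.2 hb.2), mul_nonneg (sub_nonneg.2 ha.1) (sub_nonneg.2 hb.1),
      mul_nonneg (sub_nonneg.2 ha.2) (sub_nonneg.2 hb.2)]
  by_contra hlt
  push Not at hlt
  nlinarith

instance : IsPrincipalIdealRing EisensteinInt := by
  let E : EuclideanDomain EisensteinInt :=
    { (inferInstance : CommRing EisensteinInt),
      (inferInstance : Nontrivial EisensteinInt) with
      quotient := fun z v => open Classical in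
        if hv : v = 0 then 0 else (exists_norm_sub_mul_lt z v hv).choose
      quotient_zero := fun z => by simp
      remainder := fun z v => open Classical in
        z - v * (if hv : v = 0 then 0 else (exists_norm_sub_mul_lt z v hv).choose)
      quotient_mul_add_remainder_eq := fun z v => by ring
      r := fun z v => (norm z).toNat < (norm v).toNat
      r_wellFounded := (measure fun z : EisensteinInt => (norm z).toNat).wf
      remainder_lt := fun z v hv => by
        simp only [hv, dite_false]
        have := (exists_norm_sub_mul_lt z v hv).choose_spec
        have h0 := norm_nonneg (z - v * (exists_norm_sub_mul_lt z v hv).choose)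
        omega
      mul_left_not_lt := fun a b hb => by
        rw [map_mul]
        have h1 : 0 < norm b := lt_of_le_of_ne (norm_nonneg b)
          (fun h => hb (norm_eq_zero.1 h.symm))
        have h2 := norm_nonneg a
        have : norm a ≤ norm a * norm b := by nlinarith
        omega }
  exact @EuclideanDomain.to_principal_ideal_domain EisensteinInt E

lemma w_sq : w ^ 2 = -1 - w := by
  ext <;> simp [pow_two]

lemma w_cube : w ^ 3 = 1 := by
  rw [pow_succ, w_sq, sub_mul, ← pow_two, w_sq]; ring

lemma star_w : star w = w ^ 2 := by
  rw [w_sq]; ext <;> simp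

lemma isPrimitiveRoot_w : IsPrimitiveRoot w 3 := by
  have h : orderOf w = 3 := orderOf_eq_prime w_cube
    fun h => by simpa using congrArg QuadraticAlgebra.im h
  exact h ▸ IsPrimitiveRoot.orderOf w

lemma eq_of_norm_eq_one {z : EisensteinInt} (hz : norm z = 1) :
    ∃ k : ℕ, z = w ^ k ∨ z = -w ^ k := by
  rw [norm_eq] at hz
  have h1 : z.re ≤ 1 := by nlinarith [sq_nonneg (2 * z.im - z.re)]
  have h2 : -1 ≤ z.re := by nlinarith [sq_nonneg (2 * z.im - z.re)]
  have h3 : z.im ≤ 1 := by nlinarith [sq_nonneg (2 * z.re - z.im)]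
  have h4 : -1 ≤ z.im := by nlinarith [sq_nonneg (2 * z.re - z.im)]
  obtain ⟨x, y⟩ := z
  simp only at hz h1 h2 h3 h4
  interval_cases x <;> interval_cases y <;> simp at hz
  · exact ⟨2, Or.inl (by rw [w_sq]; ext <;> simp)⟩
  · exact ⟨0, Or.inr (by ext <;> simp)⟩
  · exact ⟨1, Or.inr (by ext <;> simp)⟩
  · exact ⟨1, Or.inl (by ext <;> simp)⟩
  · exact ⟨0, Or.inl (by ext <;> simp)⟩
  · exact ⟨2, Or.inr (by rw [w_sq]; ext <;> simp)⟩

lemma isUnit_iff {z : EisensteinInt} : IsUnit z ↔ norm z = 1 := by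
  rw [isUnit_iff_norm_isUnit, Int.isUnit_iff]
  have := norm_nonneg z
  omega

/-- `z ≡ ±1 mod 3`. -/
def IsPrimary (z : EisensteinInt) : Prop := 3 ∣ z.im ∧ ¬ 3 ∣ z.re

lemma IsPrimary.of_mul {a b : EisensteinInt} (ha : IsPrimary a) (hab : IsPrimary (a * b)) :
    IsPrimary b := by
  obtain ⟨⟨x, hx⟩, ha2⟩ := ha
  obtain ⟨h1, h2⟩ := hab
  simp [hx] at h1 h2
  constructor
  · have h3 : (3 : ℤ) ∣ a.re * b.im := by
      obtain ⟨c, hc⟩ := h1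
      exact ⟨c - x * b.re + x * b.im, by linear_combination hc⟩
    exact (Int.prime_three.dvd_or_dvd h3).resolve_left ha2
  · intro h
    obtain ⟨c, hc⟩ := h
    exact h2 ⟨a.re * c - x * b.im, by rw [hc]; ring⟩

lemma isPrimary_star {a : EisensteinInt} (ha : IsPrimary a) : IsPrimary (star a) := by
  obtain ⟨⟨x, hx⟩, ha2⟩ := ha
  constructor
  · simp [hx]
  · simp [hx]; omega

/-- Modulo 3, `(x + yω)³ ≡ x³ + y³ ≡ (x + y)³`, while the norm is `(x + y)²`. -/
lemma isPrimary_cube {a : EisensteinInt} (ha : ¬ 3 ∣ norm a) : IsPrimary (a ^ 3) := by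
  obtain ⟨x, y⟩ := a
  rw [norm_eq] at ha
  simp only at ha
  have h : (⟨x, y⟩ : EisensteinInt) ^ 3 =
      ⟨x ^ 3 - 3 * x * y ^ 2 + y ^ 3, 3 * (x ^ 2 * y - x * y ^ 2)⟩ := by
    ext <;> simp [pow_succ] <;> ring
  rw [h]
  refine ⟨Dvd.intro _ rfl, fun h3 => ha ?_⟩
  simp only at h3
  have h4 : (3 : ℤ) ∣ (x + y) ^ 3 := by
    obtain ⟨c, hc⟩ := h3
    exact ⟨c + x ^ 2 * y + 2 * x * y ^ 2, by linear_combination hc⟩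
  obtain ⟨c, hc⟩ := Int.prime_three.dvd_of_dvd_pow h4
  exact ⟨c * (x + y) - x * y, by linear_combination (x + y) * hc⟩

lemma isPrimary_one_mod_three (a : EisensteinInt) (ε : ℤ) (hε : ¬ 3 ∣ ε) :
    IsPrimary (ε + 3 * a) := by
  constructor
  · simp
  · simp; omega

end EisensteinInt

/-! ### Cubic Jacobi and Gauss sums -/

namespace EisensteinInt

open QuadraticAlgebra

lemma ringHom_injective {F : Type*} [Field F] [CharZero F] (f : EisensteinInt →+* F) :
    Function.Injective f := by
  rw [injective_iff_map_eq_zero]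
  intro z hz
  have h : f (z * star z) = 0 := by rw [map_mul, hz, zero_mul]
  rw [mul_star_eq, map_intCast, Int.cast_eq_zero] at h
  exact norm_eq_zero.1 h

/-- The ring homomorphism from `ℤ[ω]` given by a root of `X² + X + 1`. -/
lemma exists_ringHom {F : Type*} [Field F] [CharZero F] {ζ : F} (hζ : IsPrimitiveRoot ζ 3) :
    ∃ f : EisensteinInt →+* F, f w = ζ := by
  have h : ζ * ζ = (-1 : ℤ) • 1 + (-1 : ℤ) • ζ := by
    have h1 := hζ.geom_sum_eq_zero (by norm_num)
    simp [Finset.sum_range_succ] at h1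
    simp
    linear_combination h1
  refine ⟨(QuadraticAlgebra.lift ⟨ζ, h⟩ : EisensteinInt →ₐ[ℤ] F), ?_⟩
  simp

lemma star_mulChar {p : ℕ} [Fact p.Prime] {χ : MulChar (ZMod p) EisensteinInt}
    (hχ : orderOf χ = 3) : χ.ringHomComp (starRingEnd EisensteinInt) = χ⁻¹ := by
  have h3 : χ ^ 3 = 1 := hχ ▸ pow_orderOf_eq_one χ
  have h2 : χ⁻¹ = χ ^ 2 := by
    rw [inv_eq_iff_mul_eq_one, ← pow_succ', h3]
  rw [h2]
  refine MulChar.ext fun a => ?_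
  obtain ⟨k, -, hk⟩ := MulChar.exists_apply_eq_pow h3 isPrimitiveRoot_w a.ne_zero
  rw [MulChar.ringHomComp_apply, MulChar.pow_apply_coe, hk, map_pow, starRingEnd_apply, star_w]
  ring

/-- Take `J = J(χ, χ)` for a cubic character `χ` modulo `p`. The Gauss sum, which lives in `F`
because `F` contains the `p`-th roots of unity, has cube `χ(-1) p J = J²J̄`. -/
theorem exists_jacobiSum (p : ℕ) [hp : Fact p.Prime] (h3 : 3 ∣ p - 1) {F : Type*} [Field F] [CharZero F]
    (f : EisensteinInt →+* F) {ζ : F} (hζ : IsPrimitiveRoot ζ p) :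
    ∃ J : EisensteinInt, J * star J = p ∧ IsPrimary J ∧ ∃ g : F, f (J ^ 2 * star J) = g ^ 3 := by
  obtain ⟨χ, hχ⟩ := MulChar.exists_mulChar_orderOf (ZMod p) (n := 3) (by rwa [ZMod.card])
    isPrimitiveRoot_w
  have hχ3 : χ ^ 3 = 1 := hχ ▸ pow_orderOf_eq_one χ
  have hχ1 : χ ≠ 1 := by rintro rfl; simp at hχ
  have hχ2 : χ * χ ≠ 1 := by
    intro h
    rw [pow_succ, pow_two, h, one_mul] at hχ3
    exact hχ1 hχ3
  have hinj := ringHom_injective f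
  have hchar : ringChar F ≠ ringChar (ZMod p) := by
    rw [ringChar.eq_zero, ZMod.ringChar_zmod_n]; exact hp.out.ne_zero.symm
  have hstar : star (jacobiSum χ χ) = jacobiSum χ⁻¹ χ⁻¹ := by
    rw [← star_mulChar hχ, jacobiSum_ringHomComp, starRingEnd_apply]
  have hnorm : jacobiSum χ χ * star (jacobiSum χ χ) = p := by
    apply hinj
    rw [hstar, map_mul, ← jacobiSum_ringHomComp, ← jacobiSum_ringHomComp,
      ← MulChar.ringHomComp_inv, jacobiSum_mul_jacobiSum_inv hchar, ZMod.card, map_natCast]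
    · exact (MulChar.ringHomComp_ne_one_iff hinj).2 hχ1
    · exact (MulChar.ringHomComp_ne_one_iff hinj).2 hχ1
    · rw [← MulChar.ringHomComp_mul]
      exact (MulChar.ringHomComp_ne_one_iff hinj).2 hχ2
  refine ⟨jacobiSum χ χ, hnorm, ?_, ?_⟩
  · obtain ⟨z, -, hz⟩ := exists_jacobiSum_eq_neg_one_add (by norm_num : 2 < 3) hχ3 hχ3
      (by rwa [ZMod.card]) isPrimitiveRoot_w
    -- The general congruence gives `-1 + z (ω - 1)²`, and `(ω - 1)² = -3ω`.
    have : jacobiSum χ χ = ((-1 : ℤ) : EisensteinInt) + 3 * (- z * w) := by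
      rw [hz]
      have := w_sq
      push_cast
      linear_combination z * this
    rw [this]
    exact isPrimary_one_mod_three _ _ (by norm_num)
  · set ψ := AddChar.zmodChar p ((IsPrimitiveRoot.iff_def ζ p).mp hζ).left
    have hψ : ψ.IsPrimitive := AddChar.zmodChar_primitive_of_primitive_root p hζ
    have hord : orderOf (χ.ringHomComp f) = 3 := by
      refine orderOf_eq_prime ?_ ((MulChar.ringHomComp_ne_one_iff hinj).2 hχ1)
      rw [MulChar.ringHomComp_pow, hχ3, MulChar.ringHomComp_one]
    refine ⟨gaussSum (χ.ringHomComp f) ψ, ?_⟩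
    have h := gaussSum_pow_eq_prod_jacobiSum (χ := χ.ringHomComp f) (by rw [hord]; norm_num) hψ
    rw [hord] at h
    have hneg : χ (-1) = 1 := by
      have h1 : χ (-1) ^ 3 = 1 := by
        rw [← MulChar.pow_apply' _ (by norm_num), hχ3, MulChar.one_apply (by simp)]
      rw [← h1, ← map_pow]; norm_num
    rw [h, MulChar.ringHomComp_apply, hneg, ZMod.card]
    simp only [Nat.reduceSub, Nat.Ico_succ_singleton, Finset.prod_singleton, pow_one, map_one,
      one_mul]
    rw [jacobiSum_ringHomComp, ← map_natCast f, ← hnorm, ← map_mul]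
    congr 1
    ring

end EisensteinInt

/-! ### Kummer theory: when `ν²ν̄` is a cube -/

namespace EisensteinInt

open QuadraticAlgebra

lemma isCoprime_star_of_mul {a b : EisensteinInt} (h : IsCoprime (a * b) (star (a * b))) :
    IsCoprime b (star b) := by
  rw [star_mul'] at h
  exact (h.of_mul_left_right).of_mul_right_right

lemma not_prime_dvd {ν : EisensteinInt} (hcop : IsCoprime ν (star ν)) {p : ℕ} (hp : p.Prime) :
    ¬ ((p : ℤ) ∣ ν.re ∧ (p : ℤ) ∣ ν.im) := by
  rintro ⟨⟨a, ha⟩, ⟨b, hb⟩⟩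
  have h : ν = p * ⟨a, b⟩ := by ext <;> simp [ha, hb]
  rw [h, star_mul', star_natCast] at hcop
  have h1 : IsUnit (p : EisensteinInt) :=
    isCoprime_self.1 (hcop.of_mul_left_left.of_mul_right_left)
  rw [isUnit_iff, QuadraticAlgebra.norm_natCast] at h1
  have := hp.one_lt
  zify at this
  nlinarith

/-- For `ν = x + yω` the residue `-x/y` is a primitive cube root of unity modulo `p`; `y` is
invertible because `p` cannot divide both coordinates. -/
lemma three_dvd_sub_one {ν : EisensteinInt} (hcop : IsCoprime ν (star ν)) {p : ℕ} (hp : p.Prime)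
    (hp3 : p ≠ 3) (hdvd : (p : ℤ) ∣ norm ν) : 3 ∣ p - 1 := by
  have : Fact p.Prime := ⟨hp⟩
  have hnd := not_prime_dvd hcop hp
  rw [norm_eq, ← ZMod.intCast_zmod_eq_zero_iff_dvd] at hdvd
  rw [← ZMod.intCast_zmod_eq_zero_iff_dvd, ← ZMod.intCast_zmod_eq_zero_iff_dvd] at hnd
  push_cast at hdvd
  set x : ZMod p := (ν.re : ZMod p)
  set y : ZMod p := (ν.im : ZMod p)
  have hy : y ≠ 0 := by
    intro hy
    apply hnd
    refine ⟨?_, hy⟩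
    rw [hy] at hdvd
    simpa using hdvd
  have hz : (-x / y) ^ 2 + (-x / y) + 1 = 0 := by
    field_simp
    linear_combination hdvd
  have hz3 : (-x / y) ^ 3 = 1 := by linear_combination (-x / y - 1) * hz
  have hz1 : (-x / y) ≠ 1 := by
    intro h
    rw [h] at hz
    have h3 : ((3 : ℕ) : ZMod p) = 0 := by push_cast; linear_combination hz
    rw [ZMod.natCast_eq_zero_iff] at h3
    exact hp3 ((Nat.prime_dvd_prime_iff_eq hp Nat.prime_three).1 h3)
  have hord : orderOf (-x / y) = 3 := orderOf_eq_prime hz3 hz1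
  rw [← hord]
  refine orderOf_dvd_of_pow_eq_one (ZMod.pow_card_sub_one_eq_one ?_)
  rintro h; rw [h] at hz; simp at hz

/-- The basic Kummer-theoretic computation: if `N(ν) = n³ ∏ p`, then `ν² ν̄` is a cube in any field
that contains the `p`-th roots of unity. -/
theorem exists_cube_eq {F : Type*} [Field F] [CharZero F] (f : EisensteinInt →+* F)
    (S : Finset ℕ) : ∀ (n : ℤ) (ν : EisensteinInt), (∀ p ∈ S, p.Prime) →
    IsCoprime ν (star ν) → ¬ 3 ∣ norm ν → norm ν = (∏ p ∈ S, (p : ℤ)) * n ^ 3 →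
    (∀ p ∈ S, ∃ ζ : F, IsPrimitiveRoot ζ p) → (IsPrimary ν ∨ ∃ z : F, z ^ 3 = f w) →
    ∃ g : F, f (ν ^ 2 * star ν) = g ^ 3 := by
  induction S using Finset.induction_on with
  | empty =>
    intro n ν _ hcop h3 hN _ h9
    rw [Finset.prod_empty, one_mul] at hN
    -- `ν ν̄ = n³` with coprime factors in a principal ideal domain, so `ν = μ³u` with `u` a unit.
    obtain ⟨μ, u, hu⟩ := exists_associated_pow_of_mul_eq_pow' hcop (k := 3) (c := (n : EisensteinInt))
      (by rw [mul_star_eq, hN]; push_cast; rfl)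
    obtain ⟨k, hk⟩ := eq_of_norm_eq_one (isUnit_iff.1 u.isUnit)
    have hμ3 : ¬ 3 ∣ norm μ := by
      intro h
      apply h3
      rw [← hu, map_mul, map_pow]
      exact (h.trans (dvd_pow_self _ (by norm_num))).mul_right _
    have key : ∀ (s : ℤ), (u : EisensteinInt) = s * w ^ k →
        (∃ z : F, z ^ 3 = f (w ^ k)) → ∃ g : F, f (ν ^ 2 * star ν) = g ^ 3 := by
      rintro s hus ⟨z, hz⟩
      -- For `u = s ω^k` one has `ν²ν̄ = s³ ω^{4k} (μ²μ̄)³`, and `ω^{4k} = ω^k (ω^k)³` with `z³` the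
      -- image of `ω^k`.
      refine ⟨s * z * f (μ ^ 2 * star μ) * f (w ^ k), ?_⟩
      rw [← hu, hus]
      simp only [star_mul', star_pow, star_w, star_intCast, map_mul, map_pow, map_intCast,
        mul_pow, hz]
      ring
    rcases h9 with h | ⟨z, hz⟩
    -- The only primary units are `±1`, so no cube root of `ω` is needed in this case.
    · have hp1 : IsPrimary (u : EisensteinInt) :=
        IsPrimary.of_mul (isPrimary_cube hμ3) (by rw [hu]; exact h)
      have hw : w ^ k = 1 := by
        have : k = 3 * (k / 3) + k % 3 := (Nat.div_add_mod k 3).symm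
        rw [this, pow_add, pow_mul, w_cube, one_pow, one_mul] at hk ⊢
        have hlt : k % 3 < 3 := Nat.mod_lt _ (by norm_num)
        interval_cases k % 3
        · simp
        · rcases hk with hk | hk <;> rw [hk] at hp1 <;> have := hp1.1 <;> simp at this
        · rcases hk with hk | hk <;> rw [hk, w_sq] at hp1 <;> have := hp1.1 <;> simp at this
      rcases hk with hk | hk
      · exact key 1 (by rw [hk]; simp) ⟨1, by rw [hw]; simp⟩
      · exact key (-1) (by rw [hk]; simp) ⟨1, by rw [hw]; simp⟩
    · have hz' : ∃ z : F, z ^ 3 = f (w ^ k) :=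
        ⟨z ^ k, by rw [← pow_mul, mul_comm, pow_mul, hz, map_pow]⟩
      rcases hk with hk | hk
      · exact key 1 (by rw [hk]; simp) hz'
      · exact key (-1) (by rw [hk]; simp) hz'
  | insert p S hpS ih =>
    intro n ν hS hcop h3 hN hζ h9
    have hp : p.Prime := hS p (Finset.mem_insert_self _ _)
    have : Fact p.Prime := ⟨hp⟩
    rw [Finset.prod_insert hpS] at hN
    have hpN : (p : ℤ) ∣ norm ν := hN ▸ (Dvd.intro _ rfl : (p : ℤ) ∣ _).mul_right _
    have hp3 : p ≠ 3 := by
      rintro rfl; exact h3 hpN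
    obtain ⟨ζ, hζp⟩ := hζ p (Finset.mem_insert_self _ _)
    obtain ⟨J, hJ, hJp, g, hg⟩ := exists_jacobiSum p (three_dvd_sub_one hcop hp hp3 hpN) f hζp
    have hnJ : norm J = p := by
      have := mul_star_eq J
      rw [hJ] at this
      exact_mod_cast this.symm
    have hJprime : Prime J := by
      have hirr : Irreducible J := by
        refine ⟨?_, fun a b hab => ?_⟩
        · rw [isUnit_iff, hnJ]; exact_mod_cast hp.one_lt.ne'
        · rw [isUnit_iff, isUnit_iff]
          have h1 : norm a * norm b = p := by rw [← map_mul, ← hab, hnJ]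
          have ha := norm_nonneg a
          have hb := norm_nonneg b
          have hpi : Irreducible (p : ℤ) := (Nat.prime_iff_prime_int.1 hp).irreducible
          rcases hpi.isUnit_or_isUnit h1.symm with h | h <;> rw [Int.isUnit_iff] at h <;> omega
      exact hirr.prime
    have hdiv : J ∣ ν * star ν := by
      rw [mul_star_eq, hN]
      push_cast
      rw [← hJ, mul_assoc, mul_assoc]
      exact Dvd.intro _ rfl
    have hpF : (p : F) ≠ 0 := by exact_mod_cast hp.ne_zero
    -- Splitting off a prime `I` above `p` is harmless, since `ν ↦ ν²ν̄` is multiplicative and the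
    -- quotient by a primary element stays primary. It will be applied to `J` and to `J̄`.
    have main : ∀ I : EisensteinInt, IsPrimary I → norm I = p → (∃ g : F, f (I ^ 2 * star I) = g ^ 3)
        → I ∣ ν → ∃ g : F, f (ν ^ 2 * star ν) = g ^ 3 := by
      rintro I hIp hIn ⟨g, hg⟩ ⟨κ, rfl⟩
      have hN' : norm κ = (∏ p ∈ S, (p : ℤ)) * n ^ 3 := by
        rw [map_mul, hIn, mul_assoc] at hN
        exact mul_left_cancel₀ (by exact_mod_cast hp.ne_zero) hN
      obtain ⟨g', hg'⟩ := ih n κ (fun q hq => hS q (Finset.mem_insert_of_mem hq))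
        (isCoprime_star_of_mul hcop) (fun h => h3 (by rw [map_mul]; exact h.mul_left _)) hN'
        (fun q hq => hζ q (Finset.mem_insert_of_mem hq)) (h9.imp_left fun h => hIp.of_mul h)
      refine ⟨g * g', ?_⟩
      rw [mul_pow g, ← hg, ← hg', ← map_mul, star_mul']
      congr 1
      ring
    rcases hJprime.dvd_or_dvd hdiv with h | h
    · exact main J hJp hnJ ⟨g, hg⟩ h
    · refine main (star J) (isPrimary_star hJp) (by rw [QuadraticAlgebra.norm_star, hnJ])
        -- The product of `J̄²J` and `J²J̄` is `p³`.
        ⟨(p : F) / g, ?_⟩ ?_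
      · have hprod : f (star J ^ 2 * star (star J)) * f (J ^ 2 * star J) = (p : F) ^ 3 := by
          rw [← map_mul, star_star, show star J ^ 2 * J * (J ^ 2 * star J) = (J * star J) ^ 3 by ring,
            hJ, map_pow, map_natCast]
        rw [hg] at hprod
        have hg0 : g ≠ 0 := by
          rintro rfl
          simp at hprod
          exact hpF ((pow_eq_zero_iff three_ne_zero).1 hprod.symm)
        rw [div_pow, eq_div_iff (pow_ne_zero _ hg0), hprod]
      · obtain ⟨c, hc⟩ := h
        exact ⟨star c, by rw [← star_mul', ← hc, star_star]⟩

end EisensteinInt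

/-! ### The element `t - 3ω`, according to `t` at 3 -/

namespace EisensteinInt

open QuadraticAlgebra

/-- The ideal `(ν, ν̄)` contains `N(ν)` and `ν - ν̄ = im(ν)(1 + 2ω)`, where `(1 + 2ω)² = -3`. -/
lemma isCoprime_star {ν : EisensteinInt} (h : IsCoprime (norm ν) (3 * ν.im)) :
    IsCoprime ν (star ν) := by
  obtain ⟨a, b, hab⟩ := h
  have h1 : ν - star ν = ν.im * (1 + 2 * w) := by
    ext <;> simp
    ring
  have h2 := mul_star_eq ν
  have h3 := w_sq
  have hab' : (a : EisensteinInt) * (norm ν : ℤ) + b * (3 * ν.im) = 1 := by exact_mod_cast hab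
  refine ⟨a * star ν - b * (1 + 2 * w), b * (1 + 2 * w), ?_⟩
  linear_combination hab' + a * h2 - b * (1 + 2 * w) * h1 - b * ν.im * 4 * h3

/-- The Eisenstein integer `t - 3ω`, of norm `Δ_t`. -/
def shanksElement (t : ℤ) : EisensteinInt := ⟨t, -3⟩

lemma norm_shanksElement (t : ℤ) : norm (shanksElement t) = shanksDelta t := by
  rw [norm_eq, shanksElement, shanksDelta]; ring

section

variable {F : Type*} [Field F] [CharZero F] (f : EisensteinInt →+* F)

theorem exists_cube_eq_of_not_three_dvd {t : ℤ} (ht : ¬ 3 ∣ t) {S : Finset ℕ} {n : ℤ}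
    (hS : ∀ p ∈ S, p.Prime) (hΔ : shanksDelta t = (∏ p ∈ S, (p : ℤ)) * n ^ 3)
    (hζ : ∀ p ∈ S, ∃ ζ : F, IsPrimitiveRoot ζ p) :
    ∃ g : F, f (shanksElement t ^ 2 * star (shanksElement t)) = g ^ 3 := by
  have h3 : ¬ 3 ∣ shanksDelta t := by
    intro h
    apply ht
    have : (3 : ℤ) ∣ t ^ 2 := by
      have e : t ^ 2 = shanksDelta t - 3 * (t + 3) := by rw [shanksDelta]; ring
      rw [e]; exact dvd_sub h (Dvd.intro _ rfl)
    exact Int.prime_three.dvd_of_dvd_pow this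
  refine exists_cube_eq f S n _ hS (isCoprime_star ?_) (by rwa [norm_shanksElement])
    (by rwa [norm_shanksElement]) hζ (Or.inl ⟨by simp [shanksElement], ht⟩)
  rw [norm_shanksElement]
  have : IsCoprime (shanksDelta t) 3 :=
    ((Int.prime_three.irreducible.coprime_iff_not_dvd).2 h3).symm
  exact this.mul_right (by simpa [shanksElement] using this.neg_right)

/-- Here `λ = 3(s - ω)` and `s - ω` is prime to 3 but not primary, so the unit in its factorization
may involve `ω`. This is why a cube root of `ω` is required and why 9 enters the conductor. -/
theorem exists_cube_eq_of_three_dvd {s : ℤ} (hs : ¬ s ≡ 1 [ZMOD 3]) {S : Finset ℕ} {n : ℤ}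
    (hS : ∀ p ∈ S, p.Prime) (hΔ : shanksDelta (3 * s) = 9 * ((∏ p ∈ S, (p : ℤ)) * n ^ 3))
    (hζ : ∀ p ∈ S, ∃ ζ : F, IsPrimitiveRoot ζ p) (h9 : ∃ z : F, z ^ 3 = f w) :
    ∃ g : F, f (shanksElement (3 * s) ^ 2 * star (shanksElement (3 * s))) = g ^ 3 := by
  have hN : norm (⟨s, -1⟩ : EisensteinInt) = s ^ 2 + s + 1 := by rw [norm_eq]; ring
  have h3 : ¬ 3 ∣ s ^ 2 + s + 1 := by
    intro h
    apply hs
    have h0 : (3 : ℤ) ∣ (s - 1) ^ 2 := by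
      have e : (s - 1) ^ 2 = s ^ 2 + s + 1 - 3 * s := by ring
      rw [e]; exact dvd_sub h (Dvd.intro _ rfl)
    exact (Int.modEq_iff_dvd.2 (Int.prime_three.dvd_of_dvd_pow h0)).symm
  obtain ⟨g, hg⟩ := exists_cube_eq f S n ⟨s, -1⟩ hS (isCoprime_star (by
    rw [hN]
    have : IsCoprime (s ^ 2 + s + 1) 3 :=
      ((Int.prime_three.irreducible.coprime_iff_not_dvd).2 h3).symm
    simpa using this.neg_right)) (by rwa [hN]) (by
      rw [hN]
      rw [shanksDelta] at hΔ
      linarith) hζ (Or.inr h9)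
  refine ⟨3 * g, ?_⟩
  have e : shanksElement (3 * s) = 3 * ⟨s, -1⟩ := by
    ext <;> simp [shanksElement]
  rw [e, mul_pow 3 g, ← hg, ← map_ofNat f 3, ← map_pow, ← map_mul, star_mul', star_ofNat]
  congr 1
  ring

/-- In this class `λ = 3(1 - ω)ω ν` with `ν` primary, and the factor `3(1 - ω)ω` contributes the
cube of `-3(1 - ω)` to `λ²λ̄`. Ninth roots of unity are thus not needed. -/
theorem exists_cube_eq_of_modEq_twelve {j : ℤ} {S : Finset ℕ} {n : ℤ}
    (hS : ∀ p ∈ S, p.Prime)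
    (hΔ : shanksDelta (27 * j + 12) = 27 * ((∏ p ∈ S, (p : ℤ)) * n ^ 3))
    (hζ : ∀ p ∈ S, ∃ ζ : F, IsPrimitiveRoot ζ p) :
    ∃ g : F, f (shanksElement (27 * j + 12) ^ 2 * star (shanksElement (27 * j + 12))) = g ^ 3 := by
  set ν : EisensteinInt := ⟨-2 - 3 * j, -3 - 6 * j⟩ with hν
  have hN : norm ν = 27 * j ^ 2 + 27 * j + 7 := by rw [norm_eq, hν]; ring
  obtain ⟨g, hg⟩ := exists_cube_eq f S n ν hS
    -- The Bézout identity is `4N(ν) = 27(2j + 1)² + 1`.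
    (isCoprime_star ⟨4, 3 * (2 * j + 1), by rw [hN, hν]; ring⟩)
    (by rw [hN]; omega)
    (by rw [shanksDelta] at hΔ; rw [hN]; linarith) hζ
    (Or.inl ⟨⟨-1 - 2 * j, by simp [hν]; ring⟩, by simp only [hν]; omega⟩)
  refine ⟨f (-3 * (1 - w)) * g, ?_⟩
  have e : shanksElement (27 * j + 12) = 3 * (1 - w) * w * ν := by
    ext <;> simp [shanksElement, hν] <;> ring
  rw [e, mul_pow _ g, ← hg, ← map_pow, ← map_mul]
  congr 1
  simp only [star_mul', star_sub, star_w, star_ofNat, star_one]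
  have h2 := w_sq
  have h3 := w_cube
  have h4 : w ^ 4 = w := by rw [pow_succ, h3, one_mul]
  have h5 : (1 - w) ^ 2 * (1 - w ^ 2) * w ^ 2 * w ^ 2 = - (1 - w) ^ 3 := by
    linear_combination ((1 - w) ^ 2 * (1 - w ^ 2)) * h4 -
      (1 - w) ^ 2 * h2 - (1 - w) ^ 2 * h3 - (1 - w) * h3
  linear_combination 27 * ν ^ 2 * star ν * h5

end

end EisensteinInt

/-! ### Cardano's formula -/

theorem aeval_shanksPoly {A : Type*} [CommRing A] (t : ℤ) (x : A) :
    aeval x (shanksPoly t) = x ^ 3 - t * x ^ 2 - (t + 3) * x - 1 := by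
  simp only [shanksPoly, map_sub, map_mul, map_pow, aeval_X, aeval_C, map_one]
  simp only [eq_intCast]
  push_cast
  ring

/-- Cardano's formula for the Shanks polynomial. -/
theorem exists_aeval_shanksPoly_eq_zero {F : Type*} [Field F] [CharZero F]
    (f : EisensteinInt →+* F) {t : ℤ} {g : F}
    (hg : f (EisensteinInt.shanksElement t ^ 2 * star (EisensteinInt.shanksElement t)) = g ^ 3) :
    ∃ x : F, aeval x (shanksPoly t) = 0 := by
  set l := EisensteinInt.shanksElement t with hl
  have hN : f l * f (star l) = shanksDelta t := by
    rw [← map_mul, EisensteinInt.mul_star_eq, EisensteinInt.norm_shanksElement, map_intCast]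
  have hT : f l + f (star l) = 2 * t + 3 := by
    rw [← map_add]
    have : l + star l = ((2 * t + 3 : ℤ) : EisensteinInt) := by
      rw [hl, EisensteinInt.shanksElement]
      ext <;> simp [QuadraticAlgebra.re_ofNat, QuadraticAlgebra.im_ofNat]
      ring
    rw [this, map_intCast]; push_cast; ring
  have hΔ : (shanksDelta t : F) = (t : F) ^ 2 + 3 * t + 9 := by
    rw [shanksDelta]; push_cast; ring
  have hΔ0 : (shanksDelta t : F) ≠ 0 := by
    have : shanksDelta t ≠ 0 := by rw [shanksDelta]; nlinarith [sq_nonneg (2 * t + 3)]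
    exact_mod_cast this
  rw [map_mul, map_pow] at hg
  have hl0 : f l ≠ 0 := fun h => hΔ0 (by rw [← hN, h, zero_mul])
  have hg0 : g ≠ 0 := by
    rintro rfl
    have hl1 : f (star l) ≠ 0 := fun h => hΔ0 (by rw [← hN, h, mul_zero])
    simp [hl0, hl1] at hg
  set D : F := (shanksDelta t : F)
  have hg' : g ^ 3 = D * f l := by rw [← hg, ← hN]; ring
  have hg'' : (D / g) ^ 3 = D * f (star l) := by
    rw [div_pow, div_eq_iff (pow_ne_zero _ hg0), hg', ← hN]; ring
  have hgg : g * (D / g) = D := by field_simp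
  set h := D / g
  -- From `g³ = Δλ`, `h³ = Δλ̄` and `gh = Δ`, the sum `y = g + h` satisfies `y³ = 3Δy + (2t+3)Δ`,
  -- the equation of `3θ - t`.
  refine ⟨(t + g + h) / 3, ?_⟩
  rw [aeval_shanksPoly]
  have h27 : (27 : F) ≠ 0 := by norm_num
  apply mul_left_cancel₀ h27
  linear_combination hg' + hg'' + D * hT + 3 * (g + h) * hgg + (- (2 * t + 3)  - 3 * (g + h)) * hΔ *(-1)

/-! ### Primitive elements of a cubic field -/

section Generator

variable {K : Type*} [Field K] [NumberField K]

lemma isSimpleOrder_intermediateField (hdeg : Module.finrank ℚ K = 3) :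
    IsSimpleOrder (IntermediateField ℚ K) :=
  IntermediateField.isSimpleOrder_of_finrank_prime ℚ K (hdeg ▸ Nat.prime_three)

lemma adjoin_eq_top_of_forall_ne (hdeg : Module.finrank ℚ K = 3) {x : K}
    (hx : ∀ r : ℚ, x ≠ algebraMap ℚ K r) : IntermediateField.adjoin ℚ {x} = ⊤ := by
  have := isSimpleOrder_intermediateField hdeg
  rcases eq_bot_or_eq_top (IntermediateField.adjoin ℚ {x}) with h | h
  · exfalso
    rw [IntermediateField.adjoin_simple_eq_bot_iff, IntermediateField.mem_bot] at h
    obtain ⟨r, hr⟩ := h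
    exact hx r hr.symm
  · exact h

lemma natDegree_minpoly_of_adjoin_eq_top (hdeg : Module.finrank ℚ K = 3) {x : K}
    (hx : IntermediateField.adjoin ℚ {x} = ⊤) : (minpoly ℚ x).natDegree = 3 := by
  rw [← IntermediateField.adjoin.finrank (Algebra.IsIntegral.isIntegral x), hx,
    IntermediateField.finrank_top', hdeg]

lemma minpoly_eq_of_monic_of_natDegree_eq (hdeg : Module.finrank ℚ K = 3) {x : K}
    (hx : IntermediateField.adjoin ℚ {x} = ⊤) {P : ℤ[X]} (hP : P.Monic) (hP3 : P.natDegree = 3)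
    (h : aeval x P = 0) : minpoly ℚ x = P.map (algebraMap ℤ ℚ) := by
  refine eq_of_monic_of_dvd_of_natDegree_le (minpoly.monic (Algebra.IsIntegral.isIntegral x))
    (hP.map _) (minpoly.dvd ℚ x (by rwa [aeval_map_algebraMap])) ?_ |>.symm
  rw [natDegree_minpoly_of_adjoin_eq_top hdeg hx]
  exact natDegree_map_le.trans hP3.le

lemma minpoly_int_eq_of_monic_of_natDegree_eq (hdeg : Module.finrank ℚ K = 3) {x : K}
    (hx : IntermediateField.adjoin ℚ {x} = ⊤) {P : ℤ[X]} (hP : P.Monic) (hP3 : P.natDegree = 3)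
    (h : aeval x P = 0) : minpoly ℤ x = P := by
  have h1 := minpoly_eq_of_monic_of_natDegree_eq hdeg hx hP hP3 h
  rw [minpoly.isIntegrallyClosed_eq_field_fractions' ℚ ⟨P, hP, h⟩] at h1
  exact map_injective _ (algebraMap ℤ ℚ).injective_int h1

lemma exists_powerBasis_gen_eq {x : K} (hx : IntermediateField.adjoin ℚ {x} = ⊤) :
    ∃ B : PowerBasis ℚ K, B.gen = x := by
  have hint : IsIntegral ℚ x := Algebra.IsIntegral.isIntegral x
  refine ⟨PowerBasis.ofAdjoinEqTop hint ?_, PowerBasis.ofAdjoinEqTop_gen _ _⟩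
  rw [← IntermediateField.adjoin_simple_toSubalgebra_of_isAlgebraic hint.isAlgebraic, hx,
    IntermediateField.top_toSubalgebra]

lemma natDegree_shanksPoly (t : ℤ) : (shanksPoly t).natDegree = 3 := by
  rw [shanksPoly]; compute_degree!

lemma monic_shanksPoly (t : ℤ) : (shanksPoly t).Monic := by
  rw [shanksPoly]; monicity!

theorem nonempty_algHom_of_aeval_eq_zero (hdeg : Module.finrank ℚ K = 3) {t : ℤ} {θ : K}
    (hθ : IsShanksGenerator t θ) {F : Type*} [Field F] [CharZero F] [Algebra ℚ F] {x : F}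
    (hx : aeval x (shanksPoly t) = 0) : Nonempty (K →ₐ[ℚ] F) := by
  obtain ⟨B, hB⟩ := exists_powerBasis_gen_eq hθ.2
  have h := minpoly_eq_of_monic_of_natDegree_eq hdeg hθ.2 (monic_shanksPoly t)
    (natDegree_shanksPoly t) hθ.1
  exact ⟨B.lift x (by rw [hB, h, aeval_map_algebraMap, hx])⟩

lemma card_aut_eq_three [IsGalois ℚ K] (hdeg : Module.finrank ℚ K = 3) :
    Nat.card (K ≃ₐ[ℚ] K) = 3 := by
  rw [IsGalois.card_aut_eq_finrank, hdeg]

end Generator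

/-- The instance for the `ℚ`-algebra structure that comes from characteristic zero. -/
instance isCyclotomicExtension_cyclotomicField_rat (n : ℕ) :
    IsCyclotomicExtension {n} ℚ (CyclotomicField n ℚ) := by
  convert! (inferInstance : @IsCyclotomicExtension {n} ℚ (CyclotomicField n ℚ) _ _
    (CyclotomicField.algebra n ℚ))

/-! ### Galois descent between cyclotomic fields -/

section Reduction

variable {K : Type*} [Field K] [NumberField K] [IsGalois ℚ K]

/-- The restriction of `σ` to the normal subfield `K` lies in a group of order 3, where cubes and
elements of order prime to 3 are trivial. -/
lemma apply_algHom_eq (hdeg : Module.finrank ℚ K = 3) {L : Type*} [Field L] [Algebra ℚ L]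
    (φ : K →ₐ[ℚ] L) (σ : L ≃ₐ[ℚ] L)
    (hσ : (∃ k : ℕ, k.Coprime 3 ∧ σ ^ k = 1) ∨ ∃ τ : L ≃ₐ[ℚ] L, σ = τ ^ 3) (x : K) :
    σ (φ x) = φ x := by
  let := φ.toAlgebra
  have : IsScalarTower ℚ K L := IsScalarTower.of_algebraMap_eq' φ.comp_algebraMap.symm
  have h3 : ∀ g : K ≃ₐ[ℚ] K, g ^ 3 = 1 := fun g => by
    rw [← card_aut_eq_three hdeg]; exact pow_card_eq_one'
  have h1 : AlgEquiv.restrictNormalHom K σ = 1 := by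
    rcases hσ with ⟨k, hk, h⟩ | ⟨τ, rfl⟩
    · have hk' : (AlgEquiv.restrictNormalHom K σ) ^ k = 1 := by rw [← map_pow, h, map_one]
      have := (orderOf_dvd_of_pow_eq_one hk')
      have h3' := orderOf_dvd_of_pow_eq_one (h3 (AlgEquiv.restrictNormalHom K σ))
      exact orderOf_eq_one_iff.1 (Nat.eq_one_of_dvd_coprimes hk this h3')
    · rw [map_pow, h3]
  have h2 := AlgEquiv.restrictNormal_commutes σ K x
  change AlgEquiv.restrictNormal σ K = 1 at h1
  rw [h1] at h2
  exact h2.symm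

/-- The units `u ≡ 1 mod m` form the Galois group of `ℚ(ζ_M)` over `ℚ(ζ_m)`. Under `H` each of them
fixes the image of `K`, which therefore lies in `ℚ(ζ_m)`. -/
theorem nonempty_algHom_cyclotomicField_of_dvd (hdeg : Module.finrank ℚ K = 3) {M m : ℕ}
    (hM : M ≠ 0) (hm : m ∣ M)
    (H : ∀ u : (ZMod M)ˣ, (ZMod.castHom hm (ZMod m)) (u : ZMod M) = 1 →
      (∃ k : ℕ, k.Coprime 3 ∧ u ^ k = 1) ∨ ∃ v : (ZMod M)ˣ, u = v ^ 3)
    (φ : K →ₐ[ℚ] CyclotomicField M ℚ) : Nonempty (K →ₐ[ℚ] CyclotomicField m ℚ) := by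
  have : NeZero M := ⟨hM⟩
  obtain ⟨d, rfl⟩ := hm
  have hd : d ≠ 0 := right_ne_zero_of_mul hM
  have : NeZero m := ⟨left_ne_zero_of_mul hM⟩
  set L := CyclotomicField (m * d) ℚ
  set ζ : L := IsCyclotomicExtension.zeta (m * d) ℚ L
  have hζ : IsPrimitiveRoot ζ (m * d) := IsCyclotomicExtension.zeta_spec (m * d) ℚ L
  have hζd : IsPrimitiveRoot (ζ ^ d) m := hζ.pow (Nat.pos_of_ne_zero hM) (mul_comm m d)
  have hfix : ∀ x, φ x ∈ IntermediateField.adjoin ℚ {ζ ^ d} := by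
    intro x
    have : IsGalois ℚ L := IsCyclotomicExtension.isGalois {m * d} ℚ L
    rw [← IsGalois.fixedField_fixingSubgroup (IntermediateField.adjoin ℚ {ζ ^ d}),
      IntermediateField.mem_fixedField_iff]
    intro σ hσ
    apply apply_algHom_eq hdeg
    have hσζ : σ (ζ ^ d) = ζ ^ d := by
      rw [IntermediateField.mem_fixingSubgroup_iff] at hσ
      exact hσ _ (IntermediateField.mem_adjoin_simple_self ℚ _)
    set e := IsCyclotomicExtension.autEquivPow L
      (cyclotomic.irreducible_rat (Nat.pos_of_ne_zero hM)) with he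
    have hu : σ ζ = ζ ^ (e σ : ZMod (m * d)).val := by
      rw [he, IsCyclotomicExtension.autEquivPow_apply]
      exact (hζ.autToPow_spec ℚ σ).symm
    have hu1 : (ZMod.castHom (Dvd.intro d rfl) (ZMod m)) (e σ : ZMod (m * d)) = 1 := by
      have h0 : ζ ≠ 0 := hζ.ne_zero hM
      rw [map_pow, hu, ← pow_mul, mul_comm (ZMod.val _) d, pow_mul] at hσζ
      have h1 : (ζ ^ d) ^ (((e σ : ZMod (m * d)).val : ℤ) - 1) = 1 := by
        rw [zpow_sub₀ (pow_ne_zero _ h0), zpow_natCast, hσζ, zpow_one,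
          div_self (pow_ne_zero _ h0)]
      rw [hζd.zpow_eq_one_iff_dvd, ← ZMod.intCast_zmod_eq_zero_iff_dvd] at h1
      push_cast at h1
      rw [ZMod.castHom_apply, ← ZMod.natCast_val]
      linear_combination h1
    rcases H _ hu1 with ⟨k, hk, h⟩ | ⟨v, hv⟩
    · exact Or.inl ⟨k, hk, e.injective (by rw [map_pow, h, map_one])⟩
    · exact Or.inr ⟨e.symm v, e.injective (by rw [map_pow, e.apply_symm_apply, hv])⟩
  have : IsCyclotomicExtension {m} ℚ (IntermediateField.adjoin ℚ {ζ ^ d}) :=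
    hζd.intermediateField_adjoin_isCyclotomicExtension ℚ
  let ψ : K →ₐ[ℚ] IntermediateField.adjoin ℚ {ζ ^ d} := φ.codRestrict (IntermediateField.adjoin ℚ {ζ ^ d}).toSubalgebra hfix
  exact ⟨(IsCyclotomicExtension.algEquiv {m} ℚ _ (CyclotomicField m ℚ)).toAlgHom.comp ψ⟩

end Reduction

/-! ### Unramified primes in cyclotomic fields -/

section Unramified

lemma exists_pow_prime_eq_expand_add (p : ℕ) [Fact p.Prime] (g : ℤ[X]) :
    ∃ h : ℤ[X], g ^ p = expand ℤ p g + C (p : ℤ) * h := by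
  have h1 : C (p : ℤ) ∣ g ^ p - expand ℤ p g := by
    rw [C_dvd_iff_dvd_coeff]
    intro i
    have h2 : (g ^ p - expand ℤ p g).map (Int.castRingHom (ZMod p)) = 0 := by
      rw [Polynomial.map_sub, Polynomial.map_pow, map_expand, ZMod.expand_card, sub_self]
    have h3 := congrArg (fun q => q.coeff i) h2
    simp only [coeff_map, coeff_zero, eq_intCast] at h3
    exact (ZMod.intCast_zmod_eq_zero_iff_dvd _ _).1 h3
  obtain ⟨h, hh⟩ := h1
  exact ⟨h, by linear_combination hh⟩

/-- A prime `p ∤ m` is unramified in the `m`-th cyclotomic field: `𝓞 / p` is reduced. -/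
theorem exists_eq_mul_of_pow_eq_mul {m : ℕ} (hm : m ≠ 0) {p : ℕ} (hp : p.Prime) (hpm : ¬ p ∣ m)
    {L : Type*} [Field L] [CharZero L] [IsCyclotomicExtension {m} ℚ L]
    {x y : L} {k : ℕ} (hx : IsIntegral ℤ x) (hy : IsIntegral ℤ y) (hxy : x ^ k = p * y) :
    ∃ z : L, IsIntegral ℤ z ∧ x = p * z := by
  have : NeZero m := ⟨hm⟩
  have : Fact p.Prime := ⟨hp⟩
  have hp0 : (p : L) ≠ 0 := by exact_mod_cast hp.ne_zero
  set ζ : L := IsCyclotomicExtension.zeta m ℚ L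
  have hζ : IsPrimitiveRoot ζ m := IsCyclotomicExtension.zeta_spec m ℚ L
  have hζp : IsPrimitiveRoot (ζ ^ p) m :=
    hζ.pow_of_coprime p ((Nat.Prime.coprime_iff_not_dvd hp).2 hpm)
  have hirr := cyclotomic.irreducible_rat (Nat.pos_of_ne_zero hm)
  -- This is Frobenius at `p`. Writing `v = g(ζ)` gives `v^p ≡ σ(v) mod p`, so `p ∣ v^p` implies `p
  -- ∣ σ(v)`, hence `p ∣ v`.
  set σ : L ≃ₐ[ℚ] L := IsCyclotomicExtension.fromZetaAut hζp hirr
  have hσ : σ ζ = ζ ^ p := IsCyclotomicExtension.fromZetaAut_spec hζp hirr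
  have hσint : ∀ {v : L}, IsIntegral ℤ v → IsIntegral ℤ (σ.symm v) := fun hv =>
    hv.map (σ.symm.toAlgHom.restrictScalars ℤ)
  have hic := IsCyclotomicExtension.Rat.isIntegralClosure_adjoin_singleton hζ
  have step : ∀ v : L, IsIntegral ℤ v → (∃ u, IsIntegral ℤ u ∧ v ^ p = p * u) →
      ∃ u, IsIntegral ℤ u ∧ v = p * u := by
    rintro v hv ⟨u, hu, huv⟩
    obtain ⟨⟨v', hv'⟩, hvv⟩ := hic.isIntegral_iff.1 hv
    have hvv' : v' = v := hvv
    rw [hvv', Algebra.adjoin_singleton_eq_range_aeval] at hv'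
    obtain ⟨g, hg⟩ := hv'
    obtain ⟨h, hh⟩ := exists_pow_prime_eq_expand_add p g
    have hg' : aeval ζ g = v := hg
    have h1 : v ^ p = σ v + p * aeval ζ h := by
      have := congrArg (aeval ζ) hh
      rw [map_pow, hg', map_add, expand_aeval, map_mul, aeval_C] at this
      rw [this, ← hσ, ← hg']
      congr 1
      · exact aeval_algHom_apply (σ.toAlgHom.restrictScalars ℤ) ζ g
      · simp
    have hint : IsIntegral ℤ (aeval ζ h) :=
      adjoin_le_integralClosure (hζ.isIntegral (Nat.pos_of_ne_zero hm))
        (aeval_mem_adjoin_singleton ℤ ζ)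
    refine ⟨σ.symm (u - aeval ζ h), hσint (hu.sub hint), ?_⟩
    have h2 : σ v = p * (u - aeval ζ h) := by linear_combination huv - h1
    rw [← σ.symm_apply_apply v, h2, map_mul, map_natCast]
  have key : ∀ j : ℕ, (∃ u, IsIntegral ℤ u ∧ x ^ p ^ j = p * u) → ∃ u, IsIntegral ℤ u ∧ x = p * u := by
    intro j
    induction j with
    | zero => intro h; simpa using h
    | succ j ih =>
      rintro ⟨u, hu, huv⟩
      exact ih (step _ (hx.pow _) ⟨u, hu, by rw [← pow_mul, ← pow_succ, huv]⟩)
  refine key k ⟨y * x ^ (p ^ k - k), hy.mul (hx.pow _), ?_⟩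
  have hk : k ≤ p ^ k := (Nat.lt_pow_self hp.one_lt).le
  rw [← mul_assoc, ← hxy, ← pow_add, Nat.add_sub_cancel' hk]

end Unramified

/-! ### Which prime powers can divide the conductor -/

section Reduction

variable {K : Type*} [Field K] [NumberField K] [IsGalois ℚ K]

lemma exists_eq_one_add_mul {M m : ℕ} (hM : M ≠ 0) (hm : m ∣ M) {u : ZMod M}
    (hu : ZMod.castHom hm (ZMod m) u = 1) : ∃ k : ℤ, u = ((1 + m * k : ℤ) : ZMod M) := by
  have : NeZero M := ⟨hM⟩
  have h1 : ((u.val : ℤ) : ZMod m) - ((1 : ℤ) : ZMod m) = 0 := by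
    rw [ZMod.castHom_apply, ← ZMod.natCast_val] at hu
    push_cast
    rw [hu, sub_self]
  rw [← Int.cast_sub, ZMod.intCast_zmod_eq_zero_iff_dvd] at h1
  obtain ⟨k, hk⟩ := h1
  refine ⟨k, ?_⟩
  rw [show (1 + m * k : ℤ) = (u.val : ℤ) by linarith]
  simp

/-- A tame prime divides the conductor only once. -/
theorem nonempty_algHom_of_prime_mul (hdeg : Module.finrank ℚ K = 3) {m p : ℕ} (hm : m ≠ 0)
    (hp : p.Prime) (hp3 : p ≠ 3) (hpm : p ∣ m) (φ : K →ₐ[ℚ] CyclotomicField (p * m) ℚ) :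
    Nonempty (K →ₐ[ℚ] CyclotomicField m ℚ) := by
  have hM : p * m ≠ 0 := mul_ne_zero hp.ne_zero hm
  refine nonempty_algHom_cyclotomicField_of_dvd hdeg hM (Dvd.intro_left p rfl) (fun u hu => ?_) φ
  refine Or.inl ⟨p, (Nat.coprime_primes hp Nat.prime_three).2 hp3, ?_⟩
  obtain ⟨k, hk⟩ := exists_eq_one_add_mul hM _ hu
  apply Units.ext
  rw [Units.val_pow_eq_pow_val, hk, Units.val_one, ← sub_eq_zero]
  -- With `u = 1 + mk`, `u^p - 1` is `u - 1` times a sum of `p` terms, each `≡ 1 mod p` because `p ∣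
  -- m`.
  have h : ((p * m : ℕ) : ℤ) ∣ (1 + m * k) ^ p - 1 := by
    rw [← geom_sum_mul, Nat.cast_mul]
    refine mul_dvd_mul ?_ ⟨k, by ring⟩
    rw [← ZMod.intCast_zmod_eq_zero_iff_dvd]
    have hm0 : ((m : ℕ) : ZMod p) = 0 := (ZMod.natCast_eq_zero_iff _ _).2 hpm
    push_cast
    simp [hm0]
  rw [← ZMod.intCast_zmod_eq_zero_iff_dvd] at h
  push_cast at h ⊢
  exact h

/-- A unit `u ≡ 1 mod m` has `u² ≡ 1` modulo 3 and modulo `m`, hence modulo `3m`, and 2 is prime to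
3. -/
theorem nonempty_algHom_of_three_mul_of_not_dvd (hdeg : Module.finrank ℚ K = 3) {m : ℕ}
    (hm : m ≠ 0) (h3 : ¬ 3 ∣ m) (φ : K →ₐ[ℚ] CyclotomicField (3 * m) ℚ) :
    Nonempty (K →ₐ[ℚ] CyclotomicField m ℚ) := by
  have hM : 3 * m ≠ 0 := mul_ne_zero three_ne_zero hm
  refine nonempty_algHom_cyclotomicField_of_dvd hdeg hM (Dvd.intro_left 3 rfl) (fun u hu => ?_) φ
  refine Or.inl ⟨2, by norm_num, ?_⟩
  obtain ⟨k, hk⟩ := exists_eq_one_add_mul hM _ hu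
  have hu3 : ¬ (3 : ℤ) ∣ 1 + m * k := by
    intro h
    have h1 : IsUnit (ZMod.castHom (Dvd.intro m rfl) (ZMod 3) (u : ZMod (3 * m))) :=
      (u.isUnit).map _
    rw [hk, map_intCast, (ZMod.intCast_zmod_eq_zero_iff_dvd _ 3).2 h] at h1
    simp at h1
  apply Units.ext
  rw [Units.val_pow_eq_pow_val, hk, Units.val_one, ← sub_eq_zero]
  have h : ((3 * m : ℕ) : ℤ) ∣ (1 + m * k) ^ 2 - 1 := by
    rw [Nat.cast_mul]
    refine IsCoprime.mul_dvd ?_ ?_ ?_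
    · rw [Nat.isCoprime_iff_coprime]
      exact (Nat.Prime.coprime_iff_not_dvd Nat.prime_three).2 h3
    · generalize (1 + m * k : ℤ) = v at *
      have : v % 3 = 1 ∨ v % 3 = 2 := by omega
      rcases this with h | h
      · obtain ⟨c, hc⟩ : ∃ c, v = 3 * c + 1 := ⟨v / 3, by omega⟩
        exact ⟨3 * c ^ 2 + 2 * c, by rw [hc]; push_cast; ring⟩
      · obtain ⟨c, hc⟩ : ∃ c, v = 3 * c + 2 := ⟨v / 3, by omega⟩
        exact ⟨3 * c ^ 2 + 4 * c + 1, by rw [hc]; push_cast; ring⟩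
    · exact ⟨2 * k + m * k ^ 2, by ring⟩
  rw [← ZMod.intCast_zmod_eq_zero_iff_dvd] at h
  push_cast at h ⊢
  exact h

theorem nonempty_algHom_of_three_mul_of_nine_dvd (hdeg : Module.finrank ℚ K = 3) {m : ℕ}
    (hm : m ≠ 0) (h9 : 9 ∣ m) (φ : K →ₐ[ℚ] CyclotomicField (3 * m) ℚ) :
    Nonempty (K →ₐ[ℚ] CyclotomicField m ℚ) := by
  have hM : 3 * m ≠ 0 := mul_ne_zero three_ne_zero hm
  refine nonempty_algHom_cyclotomicField_of_dvd hdeg hM (Dvd.intro_left 3 rfl) (fun u hu => ?_) φ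
  obtain ⟨k, hk⟩ := exists_eq_one_add_mul hM _ hu
  obtain ⟨d, rfl⟩ := h9
  -- Modulo `27d`, `(1 + 3dk)³ ≡ 1 + 9dk`, so the whole kernel consists of cubes.
  have key : (u : ZMod (3 * (9 * d))) = ((1 + 3 * d * k : ℤ) : ZMod (3 * (9 * d))) ^ 3 := by
    rw [hk, ← sub_eq_zero, ← Int.cast_pow, ← Int.cast_sub, ZMod.intCast_zmod_eq_zero_iff_dvd]
    exact ⟨-(d * k ^ 2 + d ^ 2 * k ^ 3), by push_cast; ring⟩
  have hv : IsUnit ((1 + 3 * d * k : ℤ) : ZMod (3 * (9 * d))) := by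
    rw [← isUnit_pow_iff (three_ne_zero), ← key]; exact u.isUnit
  exact Or.inr ⟨hv.unit, Units.ext (by rw [Units.val_pow_eq_pow_val, hv.unit_spec, key])⟩

end Reduction

lemma shanksDelta_pos (t : ℤ) : 0 < shanksDelta t := by
  rw [shanksDelta]; nlinarith [sq_nonneg (2 * t + 3)]

lemma four_mul_shanksDelta (t : ℤ) : 4 * shanksDelta t = (2 * t + 3) ^ 2 + 27 := by
  rw [shanksDelta]; ring

lemma isIntegral_of_aeval_shanksPoly {L : Type*} [CommRing L] {t : ℤ} {x : L}
    (hx : aeval x (shanksPoly t) = 0) : IsIntegral ℤ x :=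
  ⟨shanksPoly t, monic_shanksPoly t, hx⟩

lemma dvd_of_intCast_eq_mul {L : Type*} [Field L] [CharZero L] {p n : ℤ} (hp : p ≠ 0) {z : L}
    (hz : IsIntegral ℤ z) (h : (n : L) = p * z) : p ∣ n := by
  have hp' : (p : L) ≠ 0 := by exact_mod_cast hp
  have hz' : z = algebraMap ℚ L ((n : ℚ) / p) := by
    rw [map_div₀, map_intCast, map_intCast, h]; field_simp
  rw [hz', isIntegral_algebraMap_iff (algebraMap ℚ L).injective,
    IsIntegrallyClosed.isIntegral_iff] at hz
  obtain ⟨y, hy⟩ := hz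
  refine ⟨y, ?_⟩
  have hp'' : (p : ℚ) ≠ 0 := by exact_mod_cast hp
  rw [eq_div_iff hp''] at hy
  have : (n : ℚ) = ((p * y : ℤ) : ℚ) := by rw [← hy]; push_cast; simp; ring
  exact_mod_cast this

/-! ### Primes that must divide the conductor -/

section Ramified

variable {L : Type*} [Field L] [CharZero L] {m : ℕ} [IsCyclotomicExtension {m} ℚ L]

/-- Since `p` is unramified, `p ∣ x³` gives `p ∣ x`, and dividing by `p³` lowers `k`. At `k = 0`, `x
= pz` gives `c = p²z³`. -/
lemma exists_eq_mul_of_cube_eq (hm : m ≠ 0) {p : ℕ} (hp : p.Prime) (hpm : ¬ p ∣ m) (k : ℕ) :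
    ∀ {x c : L}, IsIntegral ℤ x → IsIntegral ℤ c → x ^ 3 = p ^ (3 * k + 1) * c →
      ∃ z : L, IsIntegral ℤ z ∧ c = p * z := by
  have hp0 : (p : L) ≠ 0 := by exact_mod_cast hp.ne_zero
  have hpi : IsIntegral ℤ (p : L) := isIntegral_natCast p
  induction k with
  | zero =>
    intro x c hx hc h
    obtain ⟨z, hz, rfl⟩ := exists_eq_mul_of_pow_eq_mul hm hp hpm (y := c) hx hc (by rw [h]; simp)
    refine ⟨p * z ^ 3, hpi.mul (hz.pow 3), mul_left_cancel₀ hp0 ?_⟩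
    linear_combination -h
  | succ k ih =>
    intro x c hx hc h
    obtain ⟨z, hz, rfl⟩ := exists_eq_mul_of_pow_eq_mul hm hp hpm (y := p ^ (3 * k + 3) * c) hx
      ((hpi.pow _).mul hc) (by rw [h]; ring)
    refine ih hz hc (mul_left_cancel₀ (pow_ne_zero 3 hp0) ?_)
    linear_combination h

/-- A prime `p ≠ 3` with `v_p(Δ_t) ≡ 1 mod 3` ramifies in `K_t`. -/
theorem false_of_shanksDelta_eq (hm : m ≠ 0) {p : ℕ} (hp : p.Prime) (hp3 : p ≠ 3) (hpm : ¬ p ∣ m)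
    {t : ℤ} {x : L} (hx : aeval x (shanksPoly t) = 0) {k : ℕ} {e : ℤ}
    (hΔ : shanksDelta t = p ^ (3 * k + 1) * e) (he : ¬ (p : ℤ) ∣ e) : False := by
  have hxi := isIntegral_of_aeval_shanksPoly hx
  rw [aeval_shanksPoly] at hx
  have hint : ∀ n : ℤ, IsIntegral ℤ (n : L) := fun n => isIntegral_intCast n
  have hpi : IsIntegral ℤ (p : L) := isIntegral_natCast p
  set b : L := (3 : ℤ) * x - t with hb
  have hbi : IsIntegral ℤ b := ((hint 3).mul hxi).sub (hint t)
  have hΔL : (t : L) ^ 2 + 3 * t + 9 = p ^ (3 * k + 1) * e := by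
    have := congrArg (fun n : ℤ => (n : L)) hΔ
    simp only [shanksDelta] at this
    push_cast at this
    exact this
  have hb3 : b ^ 3 = p ^ (3 * k + 1) * ((e : L) * ((3 : ℤ) * b + (2 * t + 3 : ℤ))) := by
    rw [← mul_assoc, ← hΔL, hb]
    push_cast
    linear_combination 27 * hx
  have hci : IsIntegral ℤ ((e : L) * ((3 : ℤ) * b + (2 * t + 3 : ℤ))) :=
    (hint e).mul (((hint 3).mul hbi).add (hint _))
  obtain ⟨z, hz, hbz⟩ := exists_eq_mul_of_pow_eq_mul hm hp hpm (x := b) (k := 3) (y := p ^ (3 * k) *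
    ((e : L) * ((3 : ℤ) * b + (2 * t + 3 : ℤ)))) hbi ((hpi.pow _).mul hci) (by rw [hb3]; ring)
  obtain ⟨y, hy, hyz⟩ := exists_eq_mul_of_cube_eq hm hp hpm k hbi hci hb3
  -- Both `b` and `e(3b + 2t + 3)` are divisible by `p`. As `4Δ = (2t+3)² + 27`, this leaves only `p
  -- = 3`.
  have hdvd : (p : ℤ) ∣ e * (2 * t + 3) := by
    refine dvd_of_intCast_eq_mul (L := L) (by exact_mod_cast hp.ne_zero)
      (hy.sub (((hint e).mul (hint 3)).mul hz)) ?_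
    push_cast at hyz ⊢
    rw [hbz] at hyz
    linear_combination hyz
  have hpp := Nat.prime_iff_prime_int.1 hp
  have h1 := (hpp.dvd_or_dvd hdvd).resolve_left he
  have h2 : (p : ℤ) ∣ shanksDelta t := by
    rw [hΔ]; exact (dvd_pow_self _ (by omega)).mul_right _
  have h3 : (p : ℤ) ∣ 3 ^ 3 := by
    have e3 : (3 : ℤ) ^ 3 = 4 * shanksDelta t - (2 * t + 3) ^ 2 := by
      rw [four_mul_shanksDelta]; ring
    rw [e3]
    exact dvd_sub (h2.mul_left _) (h1.trans (dvd_pow_self _ two_ne_zero))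
  have h4 := hpp.dvd_of_dvd_pow h3
  have h5 : p ∣ 3 := by exact_mod_cast h4
  exact hp3 ((Nat.prime_dvd_prime_iff_eq hp Nat.prime_three).1 h5)

/-- An Eisenstein cubic has no root in a cyclotomic field that is unramified at the prime. -/
lemma false_of_eisenstein_cubic (hm : m ≠ 0) {p : ℕ} (hp : p.Prime) (hpm : ¬ p ∣ m) {x : L}
    (hxi : IsIntegral ℤ x) {a b c : ℤ} (hx : x ^ 3 + p * a * x ^ 2 + p * b * x + p * c = 0)
    (hc : ¬ (p : ℤ) ∣ c) : False := by
  have hint : ∀ n : ℤ, IsIntegral ℤ (n : L) := fun n => isIntegral_intCast n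
  have hpi : IsIntegral ℤ (p : L) := isIntegral_natCast p
  have hp0 : (p : L) ≠ 0 := by exact_mod_cast hp.ne_zero
  obtain ⟨z, hz, rfl⟩ := exists_eq_mul_of_pow_eq_mul hm hp hpm (x := x) (k := 3)
    (y := -(a * x ^ 2 + b * x + c)) hxi
    ((((hint a).mul (hxi.pow 2)).add ((hint b).mul hxi)).add (hint c)).neg
    (by linear_combination hx)
  refine hc (dvd_of_intCast_eq_mul (L := L) (by exact_mod_cast hp.ne_zero)
    (z := -(p * z ^ 3 + p * a * z ^ 2 + b * z)) ?_ ?_)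
  · exact (((hpi.mul (hz.pow 3)).add ((hpi.mul (hint a)).mul (hz.pow 2))).add
      ((hint b).mul hz)).neg
  · apply mul_left_cancel₀ hp0
    push_cast
    linear_combination hx

/-- In both classes the shift `x - (3j + 1)` satisfies a cubic that is Eisenstein at 3. -/
theorem false_of_modEq_zero_or_six (hm : m ≠ 0) (h3m : ¬ 3 ∣ m) {t : ℤ} {x : L}
    (hx : aeval x (shanksPoly t) = 0) {j : ℤ} (ht : t = 9 * j ∨ t = 9 * j + 6) : False := by
  have hxi := (isIntegral_of_aeval_shanksPoly hx).sub (isIntegral_intCast (3 * j + 1))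
  rw [aeval_shanksPoly] at hx
  rcases ht with rfl | rfl
  · refine false_of_eisenstein_cubic hm Nat.prime_three h3m hxi (a := 1) (b := -9 * j ^ 2 - 3 * j)
      (c := - 1 - 18 * j ^ 3 - 18 * j ^ 2 - 6 * j) ?_ (by push_cast; omega)
    push_cast at hx ⊢
    linear_combination hx
  · refine false_of_eisenstein_cubic hm Nat.prime_three h3m hxi (a := -1)
      (b := -9 * j ^ 2 - 15 * j - 6)
      (c := - 5 - 18 * j ^ 3 - 36 * j ^ 2 - 24 * j) ?_ (by push_cast; omega)
    push_cast at hx ⊢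
    linear_combination hx

/-- With `t = 9r + 3` and `y = x - t/3`, `y³ = 9dy + 9d(2r+1)`. If 3 were unramified, `y = 3z` would
force `3 ∣ d(2r+1)`, which holds only in the third class `t ≡ 12 mod 27`. -/
theorem false_of_modEq_three_or_twenty_one (hm : m ≠ 0) (h3m : ¬ 3 ∣ m) {t : ℤ} {x : L}
    (hx : aeval x (shanksPoly t) = 0) (ht : t ≡ 3 [ZMOD 27] ∨ t ≡ 21 [ZMOD 27]) : False := by
  obtain ⟨r, rfl, hr⟩ : ∃ r : ℤ, t = 9 * r + 3 ∧ ¬ 3 ∣ 2 * r + 1 := by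
    rw [Int.ModEq, Int.ModEq] at ht
    exact ⟨t / 9, by omega, by omega⟩
  have hint : ∀ n : ℤ, IsIntegral ℤ (n : L) := fun n => isIntegral_intCast n
  have hxi := (isIntegral_of_aeval_shanksPoly hx).sub (hint (3 * r + 1))
  rw [aeval_shanksPoly] at hx
  set y : L := x - (3 * r + 1 : ℤ) with hy
  set d : ℤ := 3 * r ^ 2 + 3 * r + 1 with hd
  have hy3 : y ^ 3 = 9 * d * y + 9 * (d * (2 * r + 1) : ℤ) := by
    rw [hy, hd]
    push_cast at hx ⊢
    linear_combination hx
  obtain ⟨z, hz, hyz⟩ := exists_eq_mul_of_pow_eq_mul hm Nat.prime_three h3m (x := y) (k := 3)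
    (y := ((3 * d : ℤ) : L) * y + (3 * (d * (2 * r + 1)) : ℤ)) hxi
    (((hint _).mul hxi).add (hint _)) (by rw [hy3]; push_cast; ring)
  have h1 : (3 : ℤ) ∣ d * (2 * r + 1) := by
    refine dvd_of_intCast_eq_mul (L := L) (by norm_num) ((hz.pow 3).sub ((hint d).mul hz)) ?_
    rw [hyz] at hy3
    have h9 : (9 : L) ≠ 0 := by norm_num
    apply mul_left_cancel₀ h9
    push_cast at hy3 ⊢
    linear_combination -hy3
  rcases Int.prime_three.dvd_or_dvd h1 with h | h
  · omega
  · exact hr h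

end Ramified

/-! ### The conductor of `K_t` -/

section Conductor

variable {K : Type*} [Field K] [NumberField K]

lemma abelianConductor_le {n : ℕ} (hn : n ≠ 0) (h : Nonempty (K →ₐ[ℚ] CyclotomicField n ℚ)) :
    abelianConductor K ≤ n :=
  Nat.sInf_le ⟨Nat.pos_of_ne_zero hn, h⟩

lemma nonempty_algHom_abelianConductor (h : abelianConductor K ≠ 0) :
    Nonempty (K →ₐ[ℚ] CyclotomicField (abelianConductor K) ℚ) :=
  (Nat.sInf_mem (Nat.nonempty_of_pos_sInf (Nat.pos_of_ne_zero h))).2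

lemma abelianConductor_eq {N : ℕ} (hN : N ≠ 0) (h : Nonempty (K →ₐ[ℚ] CyclotomicField N ℚ))
    (hmin : ∀ m : ℕ, m ≠ 0 → Nonempty (K →ₐ[ℚ] CyclotomicField m ℚ) → N ∣ m) :
    abelianConductor K = N := by
  refine le_antisymm (abelianConductor_le hN h) (le_csInf ⟨N, Nat.pos_of_ne_zero hN, h⟩ ?_)
  rintro m ⟨hm, hmK⟩
  exact Nat.le_of_dvd hm (hmin m hm.ne' hmK)

lemma exists_eq_prod_mul_cube {N : ℕ} (hN : N ≠ 0)
    (h : ∀ p : ℕ, p.Prime → ¬ padicValNat p N ≡ 2 [MOD 3]) :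
    ∃ (S : Finset ℕ) (n : ℕ), (∀ p ∈ S, p.Prime ∧ padicValNat p N % 3 = 1) ∧
      N = (∏ p ∈ S, p) * n ^ 3 := by
  refine ⟨N.primeFactors.filter (fun p => padicValNat p N % 3 = 1),
    ∏ p ∈ N.primeFactors, p ^ (padicValNat p N / 3), fun p hp => ?_, ?_⟩
  · rw [Finset.mem_filter] at hp
    exact ⟨Nat.prime_of_mem_primeFactors hp.1, hp.2⟩
  · rw [Finset.prod_filter, ← Finset.prod_pow, ← Finset.prod_mul_distrib]
    conv_lhs => rw [← Nat.prod_factorization_pow_eq_self hN]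
    refine Finset.prod_congr rfl fun p hp => ?_
    have hpp := Nat.prime_of_mem_primeFactors hp
    have h2 := h p hpp
    rw [Nat.factorization_def N hpp]
    rw [Nat.ModEq] at h2
    have h3 := Nat.div_add_mod (padicValNat p N) 3
    split_ifs with h1
    · rw [← pow_mul, ← pow_succ']
      congr 1; omega
    · rw [one_mul, ← pow_mul]
      congr 1; omega

lemma exists_eq_pow_mul_of_padicValInt {p : ℕ} (hp : p.Prime) {d : ℤ} (hd : d ≠ 0) {v : ℕ}
    (hv : padicValInt p d = v) : ∃ e : ℤ, d = p ^ v * e ∧ ¬ (p : ℤ) ∣ e := by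
  have : Fact p.Prime := ⟨hp⟩
  obtain ⟨e, he⟩ := (padicValInt_dvd_iff v d).2 (Or.inr hv.ge)
  refine ⟨e, he, ?_⟩
  rintro ⟨f, rfl⟩
  have h1 : (p : ℤ) ^ (v + 1) ∣ d := ⟨f, by rw [he]; ring⟩
  rcases (padicValInt_dvd_iff _ d).1 h1 with h | h
  · exact hd h
  · omega

variable [IsGalois ℚ K] (hdeg : Module.finrank ℚ K = 3) {t : ℤ} {θ : K}
  (hθ : IsShanksGenerator t θ)

omit [IsGalois ℚ K] in
include hθ in
lemma shanks_eq_zero_of_algHom {L : Type*} [Field L] [CharZero L] (φ : K →ₐ[ℚ] L) :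
    φ θ ^ 3 - t * φ θ ^ 2 - (t + 3) * φ θ - 1 = 0 := by
  have h := congrArg φ ((aeval_shanksPoly t θ).symm.trans hθ.1)
  have h3 : φ 3 = 3 := map_ofNat φ 3
  simpa [h3] using h

omit [IsGalois ℚ K] in
include hθ in
lemma exists_aeval_eq_zero_of_nonempty {m : ℕ}
    (h : Nonempty (K →ₐ[ℚ] CyclotomicField m ℚ)) :
    ∃ x : CyclotomicField m ℚ, x ^ 3 - t * x ^ 2 - (t + 3) * x - 1 = 0 :=
  h.elim fun φ => ⟨φ θ, shanks_eq_zero_of_algHom hθ φ⟩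

omit [IsGalois ℚ K] in
include hθ in
lemma dvd_of_padicValInt_mod_three_eq_one {p : ℕ} (hp : p.Prime) (hp3 : p ≠ 3)
    (hv : padicValInt p (shanksDelta t) % 3 = 1) {m : ℕ} (hm : m ≠ 0)
    (h : Nonempty (K →ₐ[ℚ] CyclotomicField m ℚ)) : p ∣ m := by
  by_contra hpm
  obtain ⟨x, hx⟩ := exists_aeval_eq_zero_of_nonempty hθ h
  obtain ⟨e, he, hpe⟩ := exists_eq_pow_mul_of_padicValInt hp (shanksDelta_pos t).ne'
    (v := 3 * (padicValInt p (shanksDelta t) / 3) + 1) (by omega)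
  exact false_of_shanksDelta_eq hm hp hp3 hpm ((aeval_shanksPoly t x).trans hx) he hpe

include hdeg hθ in
-- Ramification gives `3 ∣ m`. A single factor 3 could be removed by descent, leaving a level prime
-- to 3.
lemma nine_dvd_of_nonempty {j : ℤ} (ht : t = 9 * j ∨ t = 9 * j + 6) {m : ℕ} (hm : m ≠ 0)
    (h : Nonempty (K →ₐ[ℚ] CyclotomicField m ℚ)) : 9 ∣ m := by
  have key : ∀ {m : ℕ}, m ≠ 0 → Nonempty (K →ₐ[ℚ] CyclotomicField m ℚ) → 3 ∣ m := by
    intro m hm h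
    by_contra h3
    obtain ⟨x, hx⟩ := exists_aeval_eq_zero_of_nonempty hθ h
    exact false_of_modEq_zero_or_six hm h3 ((aeval_shanksPoly t x).trans hx) ht
  obtain ⟨m', rfl⟩ := key hm h
  by_cases h3 : 3 ∣ m'
  · exact mul_dvd_mul_left 3 h3
  · obtain ⟨φ⟩ := h
    have hm' : m' ≠ 0 := right_ne_zero_of_mul hm
    exact absurd (key hm' (nonempty_algHom_of_three_mul_of_not_dvd hdeg hm' h3 φ)) h3

lemma prod_dvd_of_forall_prime_dvd {S : Finset ℕ} {m : ℕ} (hS : ∀ p ∈ S, p.Prime)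
    (h : ∀ p ∈ S, p ∣ m) : ∏ p ∈ S, p ∣ m :=
  Finset.prod_dvd_of_isRelPrime (fun p hp q hq hpq =>
    (Nat.coprime_iff_isRelPrime).1 ((Nat.coprime_primes (hS p hp) (hS q hq)).2 hpq)) h

lemma not_three_dvd_prod {S : Finset ℕ} (hS : ∀ p ∈ S, p.Prime) (h3 : 3 ∉ S) :
    ¬ 3 ∣ ∏ p ∈ S, p := by
  intro h
  rw [Prime.dvd_finsetProd_iff Nat.prime_three.prime] at h
  obtain ⟨p, hp, h⟩ := h
  rw [Nat.prime_dvd_prime_iff_eq Nat.prime_three (hS p hp)] at h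
  exact h3 (h ▸ hp)

lemma exists_isPrimitiveRoot_cyclotomicField {n d : ℕ} (hn : n ≠ 0) (hd : d ∣ n) :
    ∃ ζ : CyclotomicField n ℚ, IsPrimitiveRoot ζ d := by
  have : NeZero n := ⟨hn⟩
  obtain ⟨e, he⟩ := hd
  exact ⟨_, (IsCyclotomicExtension.zeta_spec n ℚ (CyclotomicField n ℚ)).pow
    (Nat.pos_of_ne_zero hn) (he.trans (mul_comm d e))⟩


include hdeg hθ in
-- Cardano's formula needs `ω`, so the embedding is first built at level `3 ∏ p`; the superfluous 3
-- is then removed by descent.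
lemma abelianConductor_eq_prod {S : Finset ℕ}
    (hS : ∀ p ∈ S, p.Prime ∧ padicValInt p (shanksDelta t) % 3 = 1) (h3 : 3 ∉ S)
    (hcube : ∀ f : EisensteinInt →+* CyclotomicField (3 * ∏ p ∈ S, p) ℚ,
      (∀ p ∈ S, ∃ ζ : CyclotomicField (3 * ∏ p ∈ S, p) ℚ, IsPrimitiveRoot ζ p) →
      ∃ g, f (EisensteinInt.shanksElement t ^ 2 * star (EisensteinInt.shanksElement t)) = g ^ 3) :
    abelianConductor K = ∏ p ∈ S, p := by
  have hP : ∏ p ∈ S, p ≠ 0 := Finset.prod_ne_zero_iff.2 fun p hp => (hS p hp).1.ne_zero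
  have h3P : ¬ 3 ∣ ∏ p ∈ S, p := not_three_dvd_prod (fun p hp => (hS p hp).1) h3
  have hM : 3 * ∏ p ∈ S, p ≠ 0 := mul_ne_zero three_ne_zero hP
  refine abelianConductor_eq hP ?_ fun m hm hmK => ?_
  · obtain ⟨ζ, hζ⟩ := exists_isPrimitiveRoot_cyclotomicField hM (Dvd.intro _ rfl : 3 ∣ _)
    obtain ⟨f, -⟩ := EisensteinInt.exists_ringHom hζ
    obtain ⟨g, hg⟩ := hcube f fun p hp =>
      exists_isPrimitiveRoot_cyclotomicField hM ((Finset.dvd_prod_of_mem _ hp).mul_left 3)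
    obtain ⟨x, hx⟩ := exists_aeval_shanksPoly_eq_zero f hg
    obtain ⟨φ⟩ := nonempty_algHom_of_aeval_eq_zero hdeg hθ hx
    exact nonempty_algHom_of_three_mul_of_not_dvd hdeg hP h3P φ
  · exact prod_dvd_of_forall_prime_dvd (fun p hp => (hS p hp).1) fun p hp =>
      dvd_of_padicValInt_mod_three_eq_one hθ (hS p hp).1 (by rintro rfl; exact h3 hp)
        (hS p hp).2 hm hmK

include hdeg hθ in
lemma abelianConductor_eq_nine_mul_prod {S : Finset ℕ}
    (hS : ∀ p ∈ S, p.Prime ∧ padicValInt p (shanksDelta t) % 3 = 1) (h3 : 3 ∉ S) {j : ℤ}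
    (ht : t = 9 * j ∨ t = 9 * j + 6) {n : ℤ}
    (hΔ : shanksDelta t = 9 * ((∏ p ∈ S, (p : ℤ)) * n ^ 3)) :
    abelianConductor K = 9 * ∏ p ∈ S, p := by
  have hP : ∏ p ∈ S, p ≠ 0 := Finset.prod_ne_zero_iff.2 fun p hp => (hS p hp).1.ne_zero
  have h3P : ¬ 3 ∣ ∏ p ∈ S, p := not_three_dvd_prod (fun p hp => (hS p hp).1) h3
  have hM : 9 * ∏ p ∈ S, p ≠ 0 := mul_ne_zero (by norm_num) hP
  refine abelianConductor_eq hM ?_ fun m hm hmK => ?_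
  · obtain ⟨z, hz⟩ := exists_isPrimitiveRoot_cyclotomicField hM (Dvd.intro _ rfl : 9 ∣ _)
    have hζ : IsPrimitiveRoot (z ^ 3) 3 := hz.pow (by norm_num) (by norm_num)
    obtain ⟨f, hf⟩ := EisensteinInt.exists_ringHom hζ
    obtain ⟨s, rfl⟩ : (3 : ℤ) ∣ t := by omega
    have hs : ¬ s ≡ 1 [ZMOD 3] := by rw [Int.ModEq]; omega
    obtain ⟨g, hg⟩ := EisensteinInt.exists_cube_eq_of_three_dvd f hs (fun p hp => (hS p hp).1) hΔ
      (fun p hp => exists_isPrimitiveRoot_cyclotomicField hM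
        ((Finset.dvd_prod_of_mem _ hp).mul_left 9)) ⟨z, hf.symm⟩
    obtain ⟨x, hx⟩ := exists_aeval_shanksPoly_eq_zero f hg
    exact nonempty_algHom_of_aeval_eq_zero hdeg hθ hx
  · refine Nat.Coprime.mul_dvd_of_dvd_of_dvd ?_ (nine_dvd_of_nonempty hdeg hθ ht hm hmK)
      (prod_dvd_of_forall_prime_dvd (fun p hp => (hS p hp).1) fun p hp =>
        dvd_of_padicValInt_mod_three_eq_one hθ (hS p hp).1 (by rintro rfl; exact h3 hp)
          (hS p hp).2 hm hmK)
    exact Nat.Coprime.pow_left 2 ((Nat.Prime.coprime_iff_not_dvd Nat.prime_three).2 h3P)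

lemma exists_prod_mul_cube_of_shanksDelta_eq (hval : ShanksValuationCondition t) {k : ℕ} {e : ℤ}
    (he : shanksDelta t = 3 ^ k * e) (h3 : ¬ 3 ∣ e) :
    ∃ (S : Finset ℕ) (n : ℕ), (∀ p ∈ S, p.Prime ∧ padicValInt p (shanksDelta t) % 3 = 1) ∧
      3 ∉ S ∧ 0 < n ∧ e = (∏ p ∈ S, (p : ℤ)) * (n : ℤ) ^ 3 := by
  have hepos : 0 < e := by
    have := shanksDelta_pos t
    rw [he] at this
    exact pos_of_mul_pos_right this (by positivity)
  lift e to ℕ using hepos.le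
  have he0 : e ≠ 0 := by omega
  have hv : ∀ p : ℕ, p.Prime → p ≠ 3 → padicValInt p (shanksDelta t) = padicValNat p e := by
    intro p hp hp3
    have : Fact p.Prime := ⟨hp⟩
    have hN : (shanksDelta t).natAbs = 3 ^ k * e := by
      rw [he, Int.natAbs_mul, Int.natAbs_pow]; rfl
    rw [padicValInt, hN, padicValNat.mul (by positivity) he0, padicValNat.pow,
      padicValNat_primes hp3]
    simp
  have h3' : padicValNat 3 e = 0 := padicValNat.eq_zero_of_not_dvd (by exact_mod_cast h3)
  obtain ⟨S, n, hS, hn⟩ := exists_eq_prod_mul_cube he0 (fun p hp => by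
    rcases eq_or_ne p 3 with rfl | hp3
    · rw [h3']; decide
    · rw [← hv p hp hp3]; exact hval.2.2 p hp hp3)
  have h3S : 3 ∉ S := fun h => by
    have := (hS 3 h).2
    rw [h3'] at this
    norm_num at this
  refine ⟨S, n, fun p hp => ⟨(hS p hp).1, ?_⟩, h3S, ?_, ?_⟩
  · rw [hv p (hS p hp).1 (by rintro rfl; exact h3S hp)]; exact (hS p hp).2
  · refine Nat.pos_of_ne_zero ?_
    rintro rfl
    simp at hn
    exact he0 hn
  · have := congrArg (Nat.cast : ℕ → ℤ) hn
    push_cast at this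
    exact this

lemma not_three_dvd_sq_add (s : ℤ) (hs : s % 3 ≠ 1) : ¬ 3 ∣ s ^ 2 + s + 1 := by
  intro h
  have h0 : (3 : ℤ) ∣ (s - 1) ^ 2 := by
    have e : (s - 1) ^ 2 = s ^ 2 + s + 1 - 3 * s := by ring
    rw [e]; exact dvd_sub h (Dvd.intro _ rfl)
  have := Int.prime_three.dvd_of_dvd_pow h0
  omega

include hdeg hθ in
/-- The conductor of `K_t` for admissible `t`. -/
theorem exists_deltaQuotientIsCubeOf (hval : ShanksValuationCondition t) :
    ∃ n : ℕ, 0 < n ∧ DeltaQuotientIsCubeOf K t n := by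
  by_cases ht : 3 ∣ t
  · obtain ⟨s, rfl⟩ := ht
    by_cases hs : s % 3 = 1
    · have h27 : ∃ j, 3 * s = 27 * j + 12 := by
        have h1 := hval.1
        have h2 := hval.2.1
        rw [Int.ModEq] at h1 h2
        exact ⟨s / 9, by omega⟩
      obtain ⟨j, hj⟩ := h27
      rw [hj] at hval hθ ⊢
      have he : shanksDelta (27 * j + 12) = 3 ^ 3 * (27 * j ^ 2 + 27 * j + 7) := by
        rw [shanksDelta]; ring
      obtain ⟨S, n, hS, h3, hn, hd⟩ := exists_prod_mul_cube_of_shanksDelta_eq hval he (by omega)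
      rw [hd] at he
      -- For `t ≡ 12 mod 27` the conductor is prime to 3, so the exact factor 27 of `Δ_t` belongs to
      -- the cube.
      refine ⟨3 * n, by omega, ?_⟩
      rw [DeltaQuotientIsCubeOf, abelianConductor_eq_prod hdeg hθ hS h3 fun f hζ =>
        EisensteinInt.exists_cube_eq_of_modEq_twelve f (fun p hp => (hS p hp).1)
          (by rw [he]; rfl) hζ, he]
      push_cast; ring
    · have he : shanksDelta (3 * s) = 3 ^ 2 * (s ^ 2 + s + 1) := by rw [shanksDelta]; ring
      obtain ⟨S, n, hS, h3, hn, hd⟩ := exists_prod_mul_cube_of_shanksDelta_eq hval he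
        (not_three_dvd_sq_add s hs)
      rw [hd] at he
      refine ⟨n, hn, ?_⟩
      rw [DeltaQuotientIsCubeOf, abelianConductor_eq_nine_mul_prod hdeg hθ hS h3 (j := s / 3)
        (n := n) (by omega) (by rw [he]; rfl), he]
      push_cast; ring
  · have he : shanksDelta t = 3 ^ 0 * shanksDelta t := by ring
    have h3 : ¬ 3 ∣ shanksDelta t := by
      intro h
      have : (3 : ℤ) ∣ t ^ 2 := by
        have e : t ^ 2 = shanksDelta t - 3 * (t + 3) := by rw [shanksDelta]; ring
        rw [e]; exact dvd_sub h (Dvd.intro _ rfl)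
      exact ht (Int.prime_three.dvd_of_dvd_pow this)
    obtain ⟨S, n, hS, h3, hn, hd⟩ := exists_prod_mul_cube_of_shanksDelta_eq hval he h3
    refine ⟨n, hn, ?_⟩
    rw [DeltaQuotientIsCubeOf, abelianConductor_eq_prod hdeg hθ hS h3 fun f hζ =>
        EisensteinInt.exists_cube_eq_of_not_three_dvd f ht (fun p hp => (hS p hp).1) hd hζ]
    rw [hd]; push_cast; ring

include hdeg in
lemma not_sq_dvd_abelianConductor (hc0 : abelianConductor K ≠ 0) {p : ℕ} (hp : p.Prime)
    (hp3 : p ≠ 3) : ¬ p ^ 2 ∣ abelianConductor K := by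
  rintro ⟨m, hm⟩
  have hcK := nonempty_algHom_abelianConductor hc0
  have hm0 : m ≠ 0 := by rintro rfl; simp at hm; exact hc0 hm
  have hpm0 : p * m ≠ 0 := mul_ne_zero hp.ne_zero hm0
  rw [hm, pow_two, mul_assoc] at hcK
  obtain ⟨φ⟩ := hcK
  have h := abelianConductor_le hpm0
    (nonempty_algHom_of_prime_mul hdeg hpm0 hp hp3 (Dvd.intro _ rfl) φ)
  rw [hm, pow_two, mul_assoc] at h
  have := hp.two_le
  nlinarith [Nat.pos_of_ne_zero hpm0]

include hdeg in
lemma not_twenty_seven_dvd_abelianConductor (hc0 : abelianConductor K ≠ 0) :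
    ¬ 27 ∣ abelianConductor K := by
  rintro ⟨m, hm⟩
  have hcK := nonempty_algHom_abelianConductor hc0
  have hm0 : 9 * m ≠ 0 := by omega
  rw [hm, show 27 * m = 3 * (9 * m) by ring] at hcK
  obtain ⟨φ⟩ := hcK
  have h := abelianConductor_le hm0
    (nonempty_algHom_of_three_mul_of_nine_dvd hdeg hm0 (Dvd.intro _ rfl) φ)
  omega

include hdeg hθ in
-- Away from 3 the conductor is squarefree, so `v_p(Δ)` is 0 or 1 modulo 3. If `t ≡ 3, 21 mod 27`,
-- then `v_3(Δ) = 3` and 3 ramifies; hence `3 ∣ c`, so `3 ∤ n` and `27 ∣ c`, which is impossible.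
theorem shanksValuationCondition_of_deltaQuotientIsCubeOf {n : ℕ}
    (hn : DeltaQuotientIsCubeOf K t n) : ShanksValuationCondition t := by
  rw [DeltaQuotientIsCubeOf] at hn
  set c := abelianConductor K with hc
  have hpos := shanksDelta_pos t
  have hc0 : c ≠ 0 := by
    rintro h; rw [h] at hn; simp at hn; omega
  have hn0 : n ≠ 0 := by
    rintro rfl; simp at hn; omega
  have hcK := nonempty_algHom_abelianConductor hc0
  rw [← hc] at hcK
  have hmod : ¬ (t ≡ 3 [ZMOD 27] ∨ t ≡ 21 [ZMOD 27]) := by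
    intro ht
    have h3c : 3 ∣ c := by
      by_contra h3c
      obtain ⟨x, hx⟩ := exists_aeval_eq_zero_of_nonempty hθ hcK
      exact false_of_modEq_three_or_twenty_one hc0 h3c ((aeval_shanksPoly t x).trans hx) ht
    obtain ⟨m, hm⟩ := h3c
    have hm0 : m ≠ 0 := by rintro rfl; simp at hm; exact hc0 hm
    obtain ⟨r, hr⟩ : ∃ r : ℤ, t = 9 * r + 3 := by
      rw [Int.ModEq, Int.ModEq] at ht
      exact ⟨t / 9, by omega⟩
    have hmn : (m : ℤ) * n ^ 3 = 9 * (3 * r ^ 2 + 3 * r + 1) := by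
      rw [hm, hr, shanksDelta] at hn
      push_cast at hn
      linarith
    have h3n : ¬ 3 ∣ n := by
      rintro ⟨n', rfl⟩
      push_cast at hmn
      have : 3 * ((m : ℤ) * n' ^ 3) = 3 * r ^ 2 + 3 * r + 1 := by linarith
      omega
    have h9m : 9 ∣ m := by
      have h1 : ((9 : ℕ) : ℤ) ∣ (m : ℤ) * n ^ 3 := ⟨_, by rw [hmn]; rfl⟩
      have h2 : 9 ∣ m * n ^ 3 := by exact_mod_cast h1
      refine Nat.Coprime.dvd_of_dvd_mul_right ?_ h2
      exact Nat.Coprime.pow 2 3 ((Nat.Prime.coprime_iff_not_dvd Nat.prime_three).2 h3n)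
    exact not_twenty_seven_dvd_abelianConductor hdeg hc0 (hc ▸ hm ▸ mul_dvd_mul_left 3 h9m)
  refine ⟨fun h => hmod (Or.inl h), fun h => hmod (Or.inr h), fun p hp hp3 hv => ?_⟩
  have : Fact p.Prime := ⟨hp⟩
  have hvc : padicValNat p c + 3 * padicValNat p n = padicValInt p (shanksDelta t) := by
    have hN : (shanksDelta t).natAbs = c * n ^ 3 := by rw [hn]; rfl
    rw [padicValInt, hN, padicValNat.mul hc0 (pow_ne_zero 3 hn0), padicValNat.pow]
  rw [Nat.ModEq] at hv
  exact not_sq_dvd_abelianConductor hdeg hc0 hp hp3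
    ((padicValNat_dvd_iff 2 c).2 (Or.inr (by omega)))

end Conductor

/-! ### Orders in cyclic cubic fields -/

section CubicOrder

variable {K : Type*} [Field K] [NumberField K]

lemma exists_generator [IsGalois ℚ K] (hdeg : Module.finrank ℚ K = 3) :
    ∃ σ : K ≃ₐ[ℚ] K, (∀ x, σ (σ (σ x)) = x) ∧
      ∀ x, σ x = x → ∃ r : ℚ, x = algebraMap ℚ K r := by
  have hcard := card_aut_eq_three hdeg
  have : Fact (Nat.Prime 3) := ⟨Nat.prime_three⟩
  have : Nontrivial (K ≃ₐ[ℚ] K) := Finite.one_lt_card_iff_nontrivial.1 (by rw [hcard]; norm_num)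
  obtain ⟨σ, hσ⟩ := exists_ne (1 : K ≃ₐ[ℚ] K)
  refine ⟨σ, fun x => ?_, fun x hx => ?_⟩
  · have h : σ ^ 3 = 1 := by rw [← hcard]; exact pow_card_eq_one'
    exact congrArg (fun g : K ≃ₐ[ℚ] K => g x) h
  · have hb : x ∈ (⊥ : IntermediateField ℚ K) := by
      rw [IsGalois.mem_bot_iff_fixed]
      intro g
      have hg : g ∈ Subgroup.zpowers σ := mem_zpowers_of_prime_card hcard hσ
      have hle : Subgroup.zpowers σ ≤ MulAction.stabilizer (K ≃ₐ[ℚ] K) x := by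
        rw [Subgroup.zpowers_le]; exact hx
      exact hle hg
    rw [IntermediateField.mem_bot] at hb
    obtain ⟨r, hr⟩ := hb
    exact ⟨r, hr.symm⟩

lemma exists_int_eq_of_isIntegral {x : K} (hx : IsIntegral ℤ x) {r : ℚ}
    (h : x = algebraMap ℚ K r) : ∃ n : ℤ, x = n := by
  rw [h, isIntegral_algebraMap_iff (algebraMap ℚ K).injective,
    IsIntegrallyClosed.isIntegral_iff] at hx
  obtain ⟨n, rfl⟩ := hx
  exact ⟨n, by rw [h]; simp⟩

lemma isIntegral_int_algEquiv {x : K} (σ : K ≃ₐ[ℚ] K) (hx : IsIntegral ℤ x) : IsIntegral ℤ (σ x) :=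
  hx.map (σ.toAlgHom.restrictScalars ℤ)

/-- Cramer's rule for the conjugates of `1, γ, γ²`. -/
theorem exists_mul_eq_of_isIntegral {σ : K ≃ₐ[ℚ] K} (hσ3 : ∀ x, σ (σ (σ x)) = x)
    (hσ : ∀ x, σ x = x → ∃ r : ℚ, x = algebraMap ℚ K r) {γ z : K} (hγ : IsIntegral ℤ γ)
    (hz : IsIntegral ℤ z) :
    ∃ A B C : ℤ, (γ - σ γ) * (σ γ - σ (σ γ)) * (σ (σ γ) - γ) * z = A + B * γ + C * γ ^ 2 := by
  -- With `h` a cofactor of the Vandermonde matrix, the cyclic sum is integral and fixed by `σ`,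
  -- hence a rational integer.
  have key : ∀ h : K → K → K → K, (∀ x y v, IsIntegral ℤ x → IsIntegral ℤ y → IsIntegral ℤ v →
      IsIntegral ℤ (h x y v)) → (∀ x y v, σ (h x y v) = h (σ x) (σ y) (σ v)) →
      ∃ n : ℤ, z * h γ (σ γ) (σ (σ γ)) + σ z * h (σ γ) (σ (σ γ)) γ +
        σ (σ z) * h (σ (σ γ)) γ (σ γ) = n := by
    intro h hi hc
    have h1 := isIntegral_int_algEquiv σ hγ
    have h2 := isIntegral_int_algEquiv σ h1
    have h3 := isIntegral_int_algEquiv σ hz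
    have h4 := isIntegral_int_algEquiv σ h3
    obtain ⟨r, hr⟩ := hσ (z * h γ (σ γ) (σ (σ γ)) + σ z * h (σ γ) (σ (σ γ)) γ +
        σ (σ z) * h (σ (σ γ)) γ (σ γ)) (by
      simp only [map_add, map_mul, hc, hσ3]; ring)
    exact exists_int_eq_of_isIntegral (((hz.mul (hi _ _ _ hγ h1 h2)).add
      (h3.mul (hi _ _ _ h1 h2 hγ))).add (h4.mul (hi _ _ _ h2 hγ h1))) hr
  obtain ⟨A, hA⟩ := key (fun x y v => (v - y) * (y * v))
    (fun x y v _ hy hv => (hv.sub hy).mul (hy.mul hv)) (fun x y v => by simp)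
  obtain ⟨B, hB⟩ := key (fun x y v => (y - v) * (y + v))
    (fun x y v _ hy hv => (hy.sub hv).mul (hy.add hv)) (fun x y v => by simp)
  obtain ⟨C, hC⟩ := key (fun x y v => (v - y))
    (fun x y v _ hy hv => (hv.sub hy)) (fun x y v => by simp)
  refine ⟨A, B, C, ?_⟩
  rw [← hA, ← hB, ← hC]
  ring

/-- A monic integral cubic polynomial. -/
noncomputable def monicCubic (a b c : ℤ) : ℤ[X] := X ^ 3 + C a * X ^ 2 + C b * X + C c

lemma natDegree_monicCubic (a b c : ℤ) : (monicCubic a b c).natDegree = 3 := by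
  rw [monicCubic]; compute_degree!

lemma monic_monicCubic (a b c : ℤ) : (monicCubic a b c).Monic := by
  rw [monicCubic]; monicity!

lemma aeval_monicCubic {A : Type*} [CommRing A] (a b c : ℤ) (x : A) :
    aeval x (monicCubic a b c) = x ^ 3 + a * x ^ 2 + b * x + c := by
  simp only [monicCubic, map_add, map_mul, map_pow, aeval_X, aeval_C]
  simp

lemma isEisensteinAt_monicCubic {p a b c : ℤ} (hp : Prime p) (ha : p ∣ a) (hb : p ∣ b) (hc : p ∣ c)
    (hc2 : ¬ p ^ 2 ∣ c) : (monicCubic a b c).IsEisensteinAt (Submodule.span ℤ {p}) where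
  leading := by
    rw [(monic_monicCubic a b c).leadingCoeff, Ideal.submodule_span_eq, Ideal.mem_span_singleton]
    exact fun h => hp.not_isUnit (isUnit_of_dvd_one h)
  mem := by
    intro n hn
    rw [natDegree_monicCubic] at hn
    rw [Ideal.submodule_span_eq, Ideal.mem_span_singleton, monicCubic]
    simp only [coeff_add, coeff_C_mul, coeff_X_pow, coeff_X, coeff_C]
    interval_cases n <;> simpa
  notMem := by
    rw [Ideal.submodule_span_eq, Ideal.span_singleton_pow, Ideal.mem_span_singleton, monicCubic]
    simpa [coeff_X, coeff_C]

lemma mem_adjoin_of_eisenstein_cubic (hdeg : Module.finrank ℚ K = 3) {x z : K}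
    (hx : IntermediateField.adjoin ℚ {x} = ⊤) {p a b c : ℤ} (hp : Prime p)
    (h : x ^ 3 + a * x ^ 2 + b * x + c = 0) (ha : p ∣ a) (hb : p ∣ b) (hc : p ∣ c)
    (hc2 : ¬ p ^ 2 ∣ c) (hz : IsIntegral ℤ z) {k : ℕ}
    (hk : (p : K) ^ k * z ∈ Algebra.adjoin ℤ {x}) : z ∈ Algebra.adjoin ℤ {x} := by
  obtain ⟨B, rfl⟩ := exists_powerBasis_gen_eq hx
  have h0 : aeval B.gen (monicCubic a b c) = 0 := by rw [aeval_monicCubic, h]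
  have hmin := minpoly_int_eq_of_monic_of_natDegree_eq hdeg hx (monic_monicCubic a b c)
    (natDegree_monicCubic a b c) h0
  refine mem_adjoin_of_smul_prime_pow_smul_of_minpoly_isEisensteinAt hp
    ⟨_, monic_monicCubic a b c, h0⟩ hz (n := k) ?_
    (hmin ▸ isEisensteinAt_monicCubic hp ha hb hc hc2)
  rw [zsmul_eq_mul]
  push_cast
  exact hk

omit [NumberField K] in
-- The integers `N` with `Nz ∈ ℤ[γ]` form an ideal whose generator divides `d`; by hypothesis no
-- prime divides that generator.
lemma mem_adjoin_of_forall_prime {γ z : K} {d : ℤ}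
    (hdz : (d : K) * z ∈ Algebra.adjoin ℤ {γ})
    (h : ∀ p : ℕ, p.Prime → (p : ℤ) ∣ d →
      ∃ N : ℤ, ¬ (p : ℤ) ∣ N ∧ (N : K) * z ∈ Algebra.adjoin ℤ {γ}) :
    z ∈ Algebra.adjoin ℤ {γ} := by
  let I : Ideal ℤ :=
    { carrier := {N : ℤ | (N : K) * z ∈ Algebra.adjoin ℤ {γ}}
      add_mem' := fun {a b} ha hb => by
        simp only [Set.mem_ofPred_eq] at *
        push_cast
        rw [add_mul]
        exact add_mem ha hb
      zero_mem' := by simp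
      smul_mem' := fun a b hb => by
        simp only [Set.mem_ofPred_eq, smul_eq_mul] at *
        push_cast
        rw [mul_assoc]
        exact mul_mem (intCast_mem _ _) hb }
  have hI : ∀ N : ℤ, N ∈ I ↔ (N : K) * z ∈ Algebra.adjoin ℤ {γ} := fun N => Iff.rfl
  obtain ⟨g, hg⟩ := (IsPrincipalIdealRing.principal I).principal
  have hg' : ∀ N : ℤ, N ∈ I ↔ g ∣ N := fun N => by
    rw [hg, Ideal.submodule_span_eq, Ideal.mem_span_singleton]
  have hgd : g ∣ d := (hg' d).1 ((hI d).2 hdz)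
  have hunit : g.natAbs = 1 := by
    by_contra hne
    obtain ⟨p, hp, hpg⟩ := Nat.exists_prime_and_dvd hne
    have hpg' : (p : ℤ) ∣ g := Int.natCast_dvd.2 hpg
    obtain ⟨N, hN, hNz⟩ := h p hp (hpg'.trans hgd)
    exact hN (hpg'.trans ((hg' N).1 ((hI N).2 hNz)))
  have h1 : (1 : ℤ) ∈ I := (hg' 1).2 (Int.natAbs_dvd.1 (by rw [hunit]; simp))
  simpa using (hI 1).1 h1

lemma generatesIntegers_iff {γ : 𝓞 K} :
    GeneratesIntegers γ ↔ ∀ z : K, IsIntegral ℤ z → z ∈ Algebra.adjoin ℤ {(γ : K)} := by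
  have hmap : (Algebra.adjoin ℤ {γ}).map (Algebra.algHom ℤ (𝓞 K) K) =
      Algebra.adjoin ℤ {(γ : K)} := by
    rw [AlgHom.map_adjoin_singleton]; rfl
  constructor
  · intro h z hz
    rw [← hmap, h]
    exact ⟨⟨z, hz⟩, Algebra.mem_top, rfl⟩
  · intro h
    refine (Algebra.eq_top_iff).2 fun z => ?_
    have hz := h z z.2
    rw [← hmap] at hz
    obtain ⟨y, hy, hyz⟩ := hz
    have : y = z := RingOfIntegers.ext hyz
    exact this ▸ hy

lemma apply_ne_of_adjoin_eq_top (hdeg : Module.finrank ℚ K = 3) {σ : K ≃ₐ[ℚ] K}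
    (hσ : ∀ x, σ x = x → ∃ r : ℚ, x = algebraMap ℚ K r) {x : K}
    (hx : IntermediateField.adjoin ℚ {x} = ⊤) : σ x ≠ x := by
  intro h
  obtain ⟨r, hr⟩ := hσ x h
  have h3 : IntermediateField.adjoin ℚ {x} = ⊥ := by
    rw [IntermediateField.adjoin_simple_eq_bot_iff, IntermediateField.mem_bot]
    exact ⟨r, hr.symm⟩
  rw [h3] at hx
  have h2 := (IntermediateField.finrank_bot' (F := ℚ) (E := K))
  rw [hx, IntermediateField.finrank_top, hdeg] at h2
  norm_num at h2

end CubicOrder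

/-! ### The generator `(θ - a)/n` -/

section Generator

/-- This and the next identity express `f_t'(a)` and `f_t(a)` through `t - 3a` and `Δ_t`, so that `n
∣ t - 3a` and `n³ ∣ Δ_t` control their divisibility by `n²` and `n³`. -/
lemma three_mul_shanksDelta_sub (t a : ℤ) :
    3 * (3 * a ^ 2 - 2 * t * a - (t + 3)) = (t - 3 * a) ^ 2 - shanksDelta t := by
  rw [shanksDelta]; ring

lemma twenty_seven_mul_shanks (t a : ℤ) :
    27 * (a ^ 3 - t * a ^ 2 - (t + 3) * a - 1) =
      3 * shanksDelta t * (t - 3 * a) - (t - 3 * a) ^ 3 - (2 * t + 3) * shanksDelta t := by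
  rw [shanksDelta]; ring

/-- The arithmetic of `Δ_t = c n³` at the prime `3`. -/
lemma three_cases {t c : ℤ} {n : ℕ} (hval : ShanksValuationCondition t)
    (hΔ : shanksDelta t = c * (n : ℤ) ^ 3) (h27 : ¬ 27 ∣ c) :
    (¬ 3 ∣ c ∧ ¬ 3 ∣ n) ∨ (3 ∣ c ∧ ¬ 3 ∣ n ∧ ∃ j : ℤ, t = 9 * j ∨ t = 9 * j + 6) ∨
      (¬ 3 ∣ c ∧ ∃ j : ℤ, ∃ m : ℕ, t = 27 * j + 12 ∧ n = 3 * m) := by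
  by_cases hn : 3 ∣ n
  · obtain ⟨m, rfl⟩ := hn
    right; right
    have h1 : shanksDelta t = 27 * (c * m ^ 3) := by rw [hΔ]; push_cast; ring
    have h3 : (3 : ℤ) ∣ t := by
      have : (3 : ℤ) ∣ t ^ 2 := by
        rw [shanksDelta] at h1
        exact ⟨9 * (c * m ^ 3) - t - 3, by linarith⟩
      exact Int.prime_three.dvd_of_dvd_pow this
    obtain ⟨s, rfl⟩ := h3
    have h2 : s ^ 2 + s + 1 = 3 * (c * m ^ 3) := by
      rw [shanksDelta] at h1; linarith
    have hs : s % 3 = 1 := by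
      by_contra hs
      exact not_three_dvd_sq_add s hs ⟨_, h2⟩
    have hv1 := hval.1
    have hv2 := hval.2.1
    rw [Int.ModEq] at hv1 hv2
    refine ⟨?_, s / 9, m, by omega, rfl⟩
    rintro ⟨d, rfl⟩
    obtain ⟨u, rfl⟩ : ∃ u, s = 3 * u + 1 := ⟨s / 3, by omega⟩
    have h5 : 3 * u ^ 2 + 3 * u + 1 = 3 * (d * m ^ 3) := by linarith
    omega
  · by_cases hc : 3 ∣ c
    · right; left
      refine ⟨hc, hn, ?_⟩
      obtain ⟨d, rfl⟩ := hc
      have h3 : (3 : ℤ) ∣ t := by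
        have : (3 : ℤ) ∣ t ^ 2 := by
          rw [shanksDelta] at hΔ
          exact ⟨d * n ^ 3 - t - 3, by linarith⟩
        exact Int.prime_three.dvd_of_dvd_pow this
      obtain ⟨s, rfl⟩ := h3
      by_cases hs : s % 3 = 1
      · exfalso
        have hd : shanksDelta (3 * s) = 27 * ((s ^ 2 + s + 1) / 3) := by
          obtain ⟨u, rfl⟩ : ∃ u, s = 3 * u + 1 := ⟨s / 3, by omega⟩
          rw [shanksDelta, show (3 * u + 1) ^ 2 + (3 * u + 1) + 1 = 3 * (3 * u ^ 2 + 3 * u + 1) by ring,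
            Int.mul_ediv_cancel_left _ (by norm_num)]
          ring
        apply h27
        refine IsCoprime.dvd_of_dvd_mul_right (?_ : IsCoprime (27 : ℤ) ((n : ℤ) ^ 3))
          (hΔ ▸ ⟨_, hd⟩)
        have : IsCoprime (3 : ℤ) n :=
          (Int.prime_three.irreducible.coprime_iff_not_dvd).2 (by exact_mod_cast hn)
        exact (this.pow (m := 3) (n := 3))
      · exact ⟨s / 3, by omega⟩
    · exact Or.inl ⟨hc, hn⟩

/-- Integrality of the coefficients of the minimal polynomial of `(θ - a) / n`. -/
lemma exists_shifted_coeffs {t c : ℤ} {n : ℕ} (hn0 : n ≠ 0) (hval : ShanksValuationCondition t)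
    (hΔ : shanksDelta t = c * (n : ℤ) ^ 3) (h27 : ¬ 27 ∣ c) {a : ℤ} (ha : CongruentToThird t n a) :
    ∃ T E G : ℤ, 3 * a - t = n * T ∧ 3 * a ^ 2 - 2 * t * a - (t + 3) = n ^ 2 * E ∧
      a ^ 3 - t * a ^ 2 - (t + 3) * a - 1 = n ^ 3 * G := by
  have h1 := three_mul_shanksDelta_sub t a
  have h2 := twenty_seven_mul_shanks t a
  rw [hΔ] at h1 h2
  by_cases h3 : 3 ∣ n
  · obtain ⟨j, m, rfl, rfl⟩ : ∃ j : ℤ, ∃ m : ℕ, t = 27 * j + 12 ∧ n = 3 * m := by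
      rcases three_cases hval hΔ h27 with h | h | h
      · exact absurd h3 h.2
      · exact absurd h3 h.2.1
      · exact h.2
    obtain ⟨s, hs, has⟩ := ha.1 h3
    obtain ⟨u, hu⟩ := has.dvd
    obtain rfl : s = a + (3 * m : ℕ) * u := by linarith
    have hta : 27 * j + 12 - 3 * a = 9 * m * u := by push_cast at hs; linarith
    rw [hta] at h1 h2
    push_cast at *
    -- The factors 3 and 27 cancel because `t - 3a = 9mu`, `Δ = 27cm³` and `2t + 3 = 27(2j + 1)`.
    refine ⟨-3 * u, 3 * u ^ 2 - c * m, -u ^ 3 + c * m * u - (2 * j + 1) * c, by linarith, ?_, ?_⟩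
    · linarith
    · linarith
  · have hcop : IsCoprime (n : ℤ) 3 :=
      ((Int.prime_three.irreducible.coprime_iff_not_dvd).2 (by exact_mod_cast h3)).symm
    obtain ⟨T, hT⟩ := (ha.2 h3).symm.dvd
    have hta : t - 3 * a = - (n * T) := by linarith
    rw [hta] at h1 h2
    have hE : (n : ℤ) ^ 2 ∣ 3 * a ^ 2 - 2 * t * a - (t + 3) :=
      (hcop.pow_left (m := 2)).dvd_of_dvd_mul_left ⟨T ^ 2 - c * n, by rw [h1]; ring⟩
    have hG : (n : ℤ) ^ 3 ∣ a ^ 3 - t * a ^ 2 - (t + 3) * a - 1 :=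
      ((hcop.pow (m := 3) (n := 3)) : IsCoprime ((n : ℤ) ^ 3) (3 ^ 3)).dvd_of_dvd_mul_left
        ⟨-3 * c * n * T + T ^ 3 - (2 * t + 3) * c, by norm_num; rw [h2]; ring⟩
    obtain ⟨E, hE⟩ := hE
    obtain ⟨G, hG⟩ := hG
    exact ⟨T, E, G, hT, hE, hG⟩

lemma exists_congruentToThird {t : ℤ} {n : ℕ} (h : 3 ∣ n → 3 ∣ t) :
    ∃ a : ℤ, CongruentToThird t n a := by
  by_cases h3 : 3 ∣ n
  · obtain ⟨s, hs⟩ := h h3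
    exact ⟨s, fun _ => ⟨s, hs, rfl⟩, fun hn => absurd h3 hn⟩
  · have hcop : IsCoprime (3 : ℤ) n :=
      (Int.prime_three.irreducible.coprime_iff_not_dvd).2 (by exact_mod_cast h3)
    obtain ⟨u, v, huv⟩ := hcop
    refine ⟨u * t, fun hn => absurd hn h3, fun _ => ?_⟩
    exact Int.modEq_iff_dvd.2 ⟨v * t, by linear_combination -t * huv⟩

variable {K : Type*} [Field K] [NumberField K]

lemma adjoin_eq_top_of_mem {x y : K} (hx : IntermediateField.adjoin ℚ {x} = ⊤)
    (h : x ∈ IntermediateField.adjoin ℚ {y}) : IntermediateField.adjoin ℚ {y} = ⊤ := by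
  rw [eq_top_iff, ← hx, IntermediateField.adjoin_le_iff]
  simpa using h

/-- Conjugates of a root of the Shanks polynomial: their differences multiply to `± Δ_t`. -/
lemma prod_sub_sq_eq {σ : K ≃ₐ[ℚ] K} (hσ3 : ∀ x, σ (σ (σ x)) = x) {t : ℤ} {θ : K}
    (hθ : aeval θ (shanksPoly t) = 0) (hne : σ θ ≠ θ) :
    ((θ - σ θ) * (σ θ - σ (σ θ)) * (σ (σ θ) - θ)) ^ 2 = (shanksDelta t : K) ^ 2 := by
  rw [aeval_shanksPoly] at hθ
  have h3 : σ 3 = 3 := map_ofNat σ 3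
  have h1 := congrArg σ hθ
  simp only [map_sub, map_mul, map_pow, map_add, map_intCast, map_one, map_zero, h3] at h1
  have h2 := congrArg σ h1
  simp only [map_sub, map_mul, map_pow, map_add, map_intCast, map_one, map_zero, h3] at h2
  have hne2 : σ (σ θ) ≠ σ θ := fun h => hne (σ.injective h)
  have hne3 : σ (σ θ) ≠ θ := fun h => hne2 (by
    have := congrArg σ h
    rw [hσ3] at this
    exact h.trans this)
  set x := θ
  set y := σ θ
  set z := σ (σ θ)
  -- Divided differences of the three equations recover Vieta's formulas; the discriminant of `f_t`
  -- is then `Δ_t²`.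
  have ha : x ^ 2 + x * y + y ^ 2 - t * (x + y) - (t + 3) = 0 := by
    apply mul_left_cancel₀ (sub_ne_zero.2 hne)
    linear_combination h1 - hθ
  have hb : x ^ 2 + x * z + z ^ 2 - t * (x + z) - (t + 3) = 0 := by
    apply mul_left_cancel₀ (sub_ne_zero.2 hne3)
    linear_combination h2 - hθ
  have e1 : x + y + z = t := by
    apply mul_left_cancel₀ (sub_ne_zero.2 hne2)
    linear_combination hb - ha
  have e2 : x * y + y * z + z * x = -(t + 3) := by
    linear_combination -ha + (x + y) * e1
  have e3 : x * y * z = 1 := by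
    linear_combination hθ - x ^ 2 * e1 + x * e2
  have hd : ((x - y) * (y - z) * (z - x)) ^ 2 = (x + y + z) ^ 2 * (x * y + y * z + z * x) ^ 2
      - 4 * (x * y + y * z + z * x) ^ 3 - 4 * (x + y + z) ^ 3 * (x * y * z)
      + 18 * (x + y + z) * (x * y + y * z + z * x) * (x * y * z) - 27 * (x * y * z) ^ 2 := by ring
  rw [hd, e1, e2, e3, shanksDelta]
  push_cast
  ring

/-- Cramer's rule gives `c 𝓞 ⊆ ℤ[γ]`. At `p = 3` a translate `γ - e` is Eisenstein, and at `p ≠ 3`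
it is `3γ + T` that is. -/
theorem exists_generatesIntegers [IsGalois ℚ K] (hdeg : Module.finrank ℚ K = 3) {t : ℤ} {θ : K}
    (hθ : IsShanksGenerator t θ) (hval : ShanksValuationCondition t) {n : ℕ} (hn0 : n ≠ 0)
    (hΔ : DeltaQuotientIsCubeOf K t n) {a : ℤ} (ha : CongruentToThird t n a) :
    ∃ γ : 𝓞 K, (γ : K) = (θ - (a : K)) / (n : K) ∧ GeneratesIntegers γ := by
  rw [DeltaQuotientIsCubeOf] at hΔ
  have hpos := shanksDelta_pos t
  have hc0 : abelianConductor K ≠ 0 := by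
    intro h; rw [h] at hΔ; simp at hΔ; omega
  have h27 : ¬ (27 : ℤ) ∣ (abelianConductor K : ℤ) := by
    exact_mod_cast not_twenty_seven_dvd_abelianConductor hdeg hc0
  have hsq : ∀ p : ℕ, p.Prime → p ≠ 3 → ¬ (p : ℤ) ^ 2 ∣ (abelianConductor K : ℤ) := by
    intro p hp hp3
    exact_mod_cast not_sq_dvd_abelianConductor hdeg hc0 hp hp3
  set c : ℤ := (abelianConductor K : ℤ) with hc
  have hc0' : c ≠ 0 := by rw [hc]; exact_mod_cast hc0
  have hnK : (n : K) ≠ 0 := by exact_mod_cast hn0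
  have hfθ : θ ^ 3 - t * θ ^ 2 - (t + 3) * θ - 1 = 0 := by rw [← aeval_shanksPoly]; exact hθ.1
  have hΔK : (t : K) ^ 2 + 3 * t + 9 = c * n ^ 3 := by
    have := congrArg (fun n : ℤ => (n : K)) hΔ
    simp only [shanksDelta] at this
    push_cast at this
    exact this
  have hroot : ∀ (b T E G : ℤ), 3 * b - t = n * T → 3 * b ^ 2 - 2 * t * b - (t + 3) = n ^ 2 * E →
      b ^ 3 - t * b ^ 2 - (t + 3) * b - 1 = n ^ 3 * G →
      ((θ - b) / n) ^ 3 + T * ((θ - b) / n) ^ 2 + E * ((θ - b) / n) + G = 0 := by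
    intro b T E G h1 h2 h3
    have h1' := congrArg (fun n : ℤ => (n : K)) h1
    have h2' := congrArg (fun n : ℤ => (n : K)) h2
    have h3' := congrArg (fun n : ℤ => (n : K)) h3
    push_cast at h1' h2' h3'
    field_simp
    linear_combination hfθ - (θ - b) ^ 2 * h1' - (θ - b) * h2' - h3'
  obtain ⟨T, E, G, hT, hE, hG⟩ := exists_shifted_coeffs hn0 hval hΔ h27 ha
  have hγroot := hroot a T E G hT hE hG
  set γ : K := (θ - a) / n with hγ
  have hγint : IsIntegral ℤ γ :=
    ⟨monicCubic T E G, monic_monicCubic T E G, by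
      rw [← aeval_def, aeval_monicCubic, hγroot]⟩
  refine ⟨⟨γ, hγint⟩, rfl, generatesIntegers_iff.2 fun z hz => ?_⟩
  change z ∈ Algebra.adjoin ℤ {γ}
  obtain ⟨σ, hσ3, hσ⟩ := exists_generator hdeg
  have hθne := apply_ne_of_adjoin_eq_top hdeg hσ hθ.2
  have hD := prod_sub_sq_eq hσ3 hθ.1 hθne
  have hσγ : σ γ = (σ θ - a) / n := by rw [hγ]; simp
  have hσσγ : σ (σ γ) = (σ (σ θ) - a) / n := by rw [hσγ]; simp
  have hdisc : ((γ - σ γ) * (σ γ - σ (σ γ)) * (σ (σ γ) - γ)) ^ 2 = (c : K) ^ 2 := by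
    have h1 : ((γ - σ γ) * (σ γ - σ (σ γ)) * (σ (σ γ) - γ)) =
        ((θ - σ θ) * (σ θ - σ (σ θ)) * (σ (σ θ) - θ)) / n ^ 3 := by
      rw [hσσγ, hσγ, hγ]
      field_simp
      ring
    rw [h1, div_pow, hD, hΔ]
    push_cast
    field_simp
  obtain ⟨A, B, C', hABC⟩ := exists_mul_eq_of_isIntegral hσ3 hσ hγint hz
  obtain ⟨A, B, C', hABC⟩ : ∃ A B C : ℤ, (c : K) * z = A + B * γ + C * γ ^ 2 := by
    rcases sq_eq_sq_iff_eq_or_eq_neg.1 hdisc with h | h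
    · exact ⟨A, B, C', by rw [← h, hABC]⟩
    · refine ⟨-A, -B, -C', ?_⟩
      rw [h] at hABC
      push_cast
      linear_combination -hABC
  have hγmem : γ ∈ Algebra.adjoin ℤ {γ} := Algebra.self_mem_adjoin_singleton ℤ γ
  have hint : ∀ (S : Subalgebra ℤ K) (m : ℤ), (m : K) ∈ S := fun S m => intCast_mem S m
  refine mem_adjoin_of_forall_prime (d := c) ?_ fun p hp hpc => ?_
  · rw [hABC]
    exact add_mem (add_mem (hint _ _) (mul_mem (hint _ _) hγmem))
      (mul_mem (hint _ _) (pow_mem hγmem 2))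
  have hpp : Prime (p : ℤ) := Nat.prime_iff_prime_int.1 hp
  obtain ⟨k, c', hcc', hpc'⟩ : ∃ (k : ℕ) (c' : ℤ), c = p ^ k * c' ∧ ¬ (p : ℤ) ∣ c' :=
    ⟨_, (Int.finiteMultiplicity_iff.2
      ⟨by simpa using hp.ne_one, hc0'⟩ : FiniteMultiplicity (p : ℤ) c).exists_eq_pow_mul_and_not_dvd⟩
  have hcK : (c : K) = p ^ k * c' := by rw [hcc']; push_cast; rfl
  have hgen : ∀ b : ℤ, ∀ y : K, θ = n * y + b → IntermediateField.adjoin ℚ {y} = ⊤ := by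
    intro b y hy
    refine adjoin_eq_top_of_mem hθ.2 ?_
    rw [hy]
    exact add_mem (mul_mem (natCast_mem _ _) (IntermediateField.mem_adjoin_simple_self ℚ y))
      (intCast_mem _ _)
  rcases eq_or_ne p 3 with rfl | hp3
  · obtain ⟨-, h3n, j, hj⟩ : 3 ∣ c ∧ ¬ 3 ∣ n ∧ ∃ j : ℤ, t = 9 * j ∨ t = 9 * j + 6 := by
      rcases three_cases hval hΔ h27 with h | h | h
      · exact absurd hpc h.1
      · exact h
      · exact absurd hpc h.1
    have h3n' : ¬ (3 : ℤ) ∣ n := by exact_mod_cast h3n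
    have hcop : IsCoprime (3 : ℤ) n := (Int.prime_three.irreducible.coprime_iff_not_dvd).2 h3n'
    -- As `n² ≡ 1 mod 3`, the translation `e = n(1 - a)` moves `a` to a residue `1 mod 3` without
    -- changing it modulo `n`; this is the centre of the Eisenstein shift at 3.
    obtain ⟨v, hv⟩ : ∃ v : ℤ, a + n * (n * (1 - a)) = 3 * v + 1 := by
      obtain ⟨q, hq | hq⟩ : ∃ q : ℤ, (n : ℤ) = 3 * q + 1 ∨ (n : ℤ) = 3 * q + 2 :=
        ⟨n / 3, by omega⟩
      · exact ⟨(3 * q ^ 2 + 2 * q) * (1 - a), by rw [hq]; ring⟩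
      · exact ⟨(3 * q ^ 2 + 4 * q + 1) * (1 - a), by rw [hq]; ring⟩
    set e : ℤ := n * (1 - a) with he
    have hcong : CongruentToThird t n (a + n * e) := by
      refine ⟨fun h => absurd h h3n, fun h => ?_⟩
      have h1 := (ha.2 h).dvd
      exact Int.modEq_iff_dvd.2 (by
        obtain ⟨w, hw⟩ := h1
        exact ⟨w - 3 * e, by linear_combination hw⟩)
    obtain ⟨T', E', G', hT', hE', hG'⟩ := exists_shifted_coeffs hn0 hval hΔ h27 hcong
    have hyroot := hroot _ T' E' G' hT' hE' hG'
    have hy : (θ - ((a + n * e : ℤ) : K)) / n = γ - e := by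
      rw [hγ]; push_cast; field_simp; ring
    rw [hy] at hyroot
    have hygen := hgen (a + n * e) (γ - e) (by rw [← hy]; field_simp; ring)
    have hT3 : (3 : ℤ) ∣ T' := by
      refine hcop.dvd_of_dvd_mul_left (hT' ▸ ?_)
      rcases hj with rfl | rfl <;> omega
    have hE3 : (3 : ℤ) ∣ E' := by
      refine (hcop.pow_right (n := 2)).dvd_of_dvd_mul_left (hE' ▸ ?_)
      rcases hj with rfl | rfl
      · exact ⟨(a + n * e) ^ 2 - 6 * j * (a + n * e) - (3 * j + 1), by ring⟩
      · exact ⟨(a + n * e) ^ 2 - (6 * j + 4) * (a + n * e) - (3 * j + 3), by ring⟩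
    have hG9 : (3 : ℤ) ∣ G' ∧ ¬ (3 : ℤ) ^ 2 ∣ G' := by
      obtain ⟨q, hq⟩ : ∃ q : ℤ, n ^ 3 * G' = 9 * q + 3 ∨ n ^ 3 * G' = 9 * q + 6 := by
        rw [← hG', hv]
        rcases hj with rfl | rfl
        · exact ⟨3 * v ^ 3 + 3 * v ^ 2 - j * (3 * v + 1) ^ 2 - j * (3 * v + 1) - 1,
            Or.inr (by ring)⟩
        · exact ⟨3 * v ^ 3 + 3 * v ^ 2 + v - j * (3 * v + 1) ^ 2 - 6 * v ^ 2 - 4 * v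
            - (j + 1) * (3 * v + 1) - 1, Or.inl (by ring)⟩
      constructor
      · refine (hcop.pow_right (n := 3)).dvd_of_dvd_mul_left ?_
        rcases hq with hq | hq <;> rw [hq] <;> omega
      · rintro ⟨w, hw⟩
        have : n ^ 3 * G' = 9 * (n ^ 3 * w) := by rw [hw]; ring
        omega
    have hadj : Algebra.adjoin ℤ {γ - (e : K)} ≤ Algebra.adjoin ℤ {γ} := by
      rw [Algebra.adjoin_le_iff, Set.singleton_subset_iff]
      exact sub_mem hγmem (hint _ _)
    refine ⟨c', hpc', hadj ?_⟩
    have hymem := Algebra.self_mem_adjoin_singleton ℤ (γ - (e : K))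
    refine mem_adjoin_of_eisenstein_cubic hdeg hygen Int.prime_three hyroot hT3 hE3 hG9.1 hG9.2
      ((isIntegral_intCast c').mul hz) (k := k) ?_
    have hz' : ((3 : ℤ) : K) ^ k * ((c' : K) * z) =
        A + B * ((γ - e) + e) + C' * ((γ - e) + e) ^ 2 := by
      rw [sub_add_cancel, ← hABC, hcK]; push_cast; ring
    rw [hz']
    exact add_mem (add_mem (hint _ _) (mul_mem (hint _ _) (add_mem hymem (hint _ _))))
      (mul_mem (hint _ _) (pow_mem (add_mem hymem (hint _ _)) 2))
  · have hTK : 3 * (a : K) - t = n * T := by exact_mod_cast congrArg (fun n : ℤ => (n : K)) hT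
    -- `x = (3θ - t)/n` satisfies `x³ = 3cn x + (2t+3)c`, which is Eisenstein at `p` since `p`
    -- divides `c` exactly once and does not divide `2t + 3`.
    set x : K := 3 * γ + T with hx
    have hxθ : x = (3 * θ - t) / n := by
      rw [hx, hγ]; field_simp; linear_combination -hTK
    have hxroot : x ^ 3 + ((0 : ℤ) : K) * x ^ 2 + ((-3 * c * n : ℤ) : K) * x +
        ((-(2 * t + 3) * c : ℤ) : K) = 0 := by
      have h1 : (3 * θ - t) ^ 3 - 3 * (c * n ^ 3) * (3 * θ - t) - (2 * t + 3) * (c * n ^ 3) = 0 := by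
        rw [← hΔK]; linear_combination 27 * hfθ
      rw [hxθ]
      push_cast
      field_simp
      linear_combination h1
    have hxgen : IntermediateField.adjoin ℚ {x} = ⊤ := by
      refine adjoin_eq_top_of_mem hθ.2 ?_
      have h1 : θ = ((3 : ℚ)⁻¹ : ℚ) • (n * x + t) := by
        rw [hxθ, Rat.smul_def]; push_cast; field_simp; ring
      rw [h1]
      exact IntermediateField.smul_mem _ (add_mem (mul_mem (natCast_mem _ _)
        (IntermediateField.mem_adjoin_simple_self ℚ x)) (intCast_mem _ _))
    have hp2t : ¬ (p : ℤ) ∣ 2 * t + 3 := by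
      intro h
      have h1 : (p : ℤ) ∣ shanksDelta t := hΔ ▸ hpc.mul_right _
      have h3 : (p : ℤ) ∣ 3 ^ 3 := by
        have e3 : (3 : ℤ) ^ 3 = 4 * shanksDelta t - (2 * t + 3) ^ 2 := by
          rw [four_mul_shanksDelta]; ring
        rw [e3]
        exact dvd_sub (h1.mul_left _) (h.trans (dvd_pow_self _ two_ne_zero))
      have h5 : p ∣ 3 := by exact_mod_cast hpp.dvd_of_dvd_pow h3
      exact hp3 ((Nat.prime_dvd_prime_iff_eq hp Nat.prime_three).1 h5)
    have hp9 : ¬ (p : ℤ) ∣ 9 * c' := by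
      intro h
      rcases hpp.dvd_or_dvd h with h | h
      · have h5 : p ∣ 3 ^ 2 := by exact_mod_cast h
        exact hp3 ((Nat.prime_dvd_prime_iff_eq hp Nat.prime_three).1 (hp.dvd_of_dvd_pow h5))
      · exact hpc' h
    have hadj : Algebra.adjoin ℤ {x} ≤ Algebra.adjoin ℤ {γ} := by
      rw [Algebra.adjoin_le_iff, Set.singleton_subset_iff]
      exact add_mem (mul_mem (by exact_mod_cast hint _ 3) hγmem) (hint _ _)
    -- The 9 clears the denominators of `γ = (x - T)/3` and `γ²`.
    refine ⟨9 * c', hp9, hadj ?_⟩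
    have hxmem := Algebra.self_mem_adjoin_singleton ℤ x
    refine mem_adjoin_of_eisenstein_cubic hdeg hxgen hpp hxroot (dvd_zero _)
      ((hpc.mul_left _).mul_right _) (hpc.mul_left _) ?_
      ((isIntegral_intCast _).mul hz) (k := k) ?_
    · rw [neg_mul, dvd_neg]
      intro h
      refine hsq p hp hp3 (IsCoprime.dvd_of_dvd_mul_left ?_ h)
      exact ((hpp.irreducible.coprime_iff_not_dvd).2 hp2t).pow_left
    have hz' : ((p : ℤ) : K) ^ k * (((9 * c' : ℤ) : K) * z) =
        ((9 * A : ℤ) : K) + ((3 * B : ℤ) : K) * (x - T) + C' * (x - T) ^ 2 := by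
      have h1 : ((p : ℤ) : K) ^ k * (((9 * c' : ℤ) : K) * z) = 9 * (c * z) := by
        rw [hcK]; push_cast; ring
      rw [h1, hABC, hx]; push_cast; ring
    rw [hz']
    exact add_mem (add_mem (hint _ _) (mul_mem (hint _ _) (sub_mem hxmem (hint _ _))))
      (mul_mem (hint _ _) (pow_mem (sub_mem hxmem (hint _ _)) 2))

end Generator

/-! ### From a power integral basis to a Shanks parameter -/

section PowerBasis

variable {K : Type*} [Field K] [NumberField K]

omit [NumberField K] in
lemma exists_coeffs_of_mem_adjoin {x : K} {a b c : ℤ} (h : x ^ 3 + a * x ^ 2 + b * x + c = 0)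
    {z : K} (hz : z ∈ Algebra.adjoin ℤ {x}) :
    ∃ A B C : ℤ, z = A + B * x + C * x ^ 2 := by
  induction hz using Algebra.adjoin_induction with
  | mem y hy => rw [Set.mem_singleton_iff] at hy; exact ⟨0, 1, 0, by rw [hy]; simp⟩
  | algebraMap n => exact ⟨n, 0, 0, by simp⟩
  | add y z _ _ hy hz =>
    obtain ⟨A, B, C, rfl⟩ := hy
    obtain ⟨A', B', C', rfl⟩ := hz
    exact ⟨A + A', B + B', C + C', by push_cast; ring⟩
  | mul y z _ _ hy hz =>
    obtain ⟨A, B, C, rfl⟩ := hy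
    obtain ⟨A', B', C', rfl⟩ := hz
    refine ⟨A * A' - c * (B * C' + C * B') + a * c * (C * C'),
      A * B' + B * A' - b * (B * C' + C * B') + (a * b - c) * (C * C'),
      A * C' + B * B' + C * A' - a * (B * C' + C * B') + (a ^ 2 - b) * (C * C'), ?_⟩
    push_cast
    linear_combination ((B * C' + C * B') + C * C' * x - a * (C * C')) * h

lemma adjoin_eq_top_of_generatesIntegers {γ : 𝓞 K} (hγ : GeneratesIntegers γ) :
    IntermediateField.adjoin ℚ {(γ : K)} = ⊤ := by
  rw [eq_top_iff]
  intro x _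
  obtain ⟨y, hy, hyx⟩ := IsAlgebraic.exists_integral_multiple
    ((IsFractionRing.isAlgebraic_iff ℤ ℚ K).2 (Algebra.IsAlgebraic.isAlgebraic x))
  have h1 := generatesIntegers_iff.1 hγ _ hyx
  have hle : Algebra.adjoin ℤ {(γ : K)} ≤
      (IntermediateField.adjoin ℚ {(γ : K)}).toSubalgebra.restrictScalars ℤ := by
    rw [Algebra.adjoin_le_iff, Set.singleton_subset_iff]
    exact IntermediateField.mem_adjoin_simple_self ℚ _
  have h2 : (y : K) * x ∈ IntermediateField.adjoin ℚ {(γ : K)} := by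
    have := hle h1
    rw [zsmul_eq_mul] at this
    exact this
  have hy0 : (y : K) ≠ 0 := by exact_mod_cast hy
  have h3 : x = (y : K)⁻¹ * ((y : K) * x) := by field_simp
  rw [h3]
  exact mul_mem (inv_mem (intCast_mem _ _)) h2

/-- The reciprocal polynomial of `f_t` is `-f_{-3-t}`; this allows `t ≥ -1` to be assumed. -/
lemma IsShanksGenerator.inv {t : ℤ} {θ : K} (h : IsShanksGenerator t θ) :
    IsShanksGenerator (-3 - t) θ⁻¹ := by
  obtain ⟨h1, h2⟩ := h
  rw [aeval_shanksPoly] at h1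
  have h0 : θ ≠ 0 := by rintro rfl; simp at h1
  refine ⟨?_, adjoin_eq_top_of_mem h2 ?_⟩
  · rw [aeval_shanksPoly]
    field_simp
    push_cast
    linear_combination -h1
  · simpa using inv_mem (IntermediateField.mem_adjoin_simple_self ℚ θ⁻¹)

lemma shanksDelta_neg_three_sub (t : ℤ) : shanksDelta (-3 - t) = shanksDelta t := by
  rw [shanksDelta, shanksDelta]; ring

lemma ShanksValuationCondition.neg_three_sub {t : ℤ} (h : ShanksValuationCondition t) :
    ShanksValuationCondition (-3 - t) := by
  obtain ⟨h1, h2, h3⟩ := h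
  rw [Int.ModEq] at h1 h2
  refine ⟨?_, ?_, ?_⟩
  · rw [Int.ModEq]; omega
  · rw [Int.ModEq]; omega
  · rwa [shanksDelta_neg_three_sub]

/-- The arithmetic of a power basis generator `γ` with `x = 3γ - T`, `x³ = 3dnx + ε(2t+3)d` and
discriminant `d²`. -/
lemma shanksValuationCondition_of_cubic {g : K} {t d n T ε : ℤ} (hε : ε = 1 ∨ ε = -1)
    (hg : IsIntegral ℤ g) (hΔ : shanksDelta t = d * n ^ 3)
    (hx : (3 * g - T) ^ 3 = 3 * (d * n) * (3 * g - T) + ε * (2 * t + 3) * d)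
    (hdvd : ∀ (z : K) (N a b c : ℤ), IsIntegral ℤ z → N * z = a + b * g + c * g ^ 2 → N ∣ c) :
    ShanksValuationCondition t := by
  have hint : ∀ m : ℤ, IsIntegral ℤ (m : K) := fun m => isIntegral_intCast m
  have hpos := shanksDelta_pos t
  have hd0 : d ≠ 0 := by rintro rfl; simp at hΔ; omega
  have hn0 : n ≠ 0 := by rintro rfl; simp at hΔ; omega
  have hsq : ∀ p : ℕ, p.Prime → p ≠ 3 → ¬ (p : ℤ) ^ 2 ∣ d := by
    rintro p hp hp3 ⟨d', rfl⟩
    have hp0 : (p : K) ≠ 0 := by exact_mod_cast hp.ne_zero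
    set s : K := (3 * d' * n : ℤ) * ((3 : ℤ) * g - T) + (ε * (2 * t + 3) * d' : ℤ) with hs
    have hsi : IsIntegral ℤ s := ((hint _).mul (((hint 3).mul hg).sub (hint _))).add (hint _)
    have hxs : (3 * g - T) ^ 3 = p ^ 2 * s := by rw [hx, hs]; push_cast; ring
    -- If `p² ∣ d`, then `(3g - T)³ = p²s`, so the cube of this quotient is `p s²`. Its `g²`
    -- coefficient `9/p` is not an integer.
    have hz : IsIntegral ℤ ((3 * g - T) ^ 2 / p) := by
      refine IsIntegral.of_pow (n := 3) (by norm_num) ?_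
      have : ((3 * g - T) ^ 2 / p) ^ 3 = (p : ℤ) * s ^ 2 := by
        rw [div_pow, ← pow_mul, mul_comm 2 3, pow_mul, hxs]
        push_cast
        field_simp
      rw [this]
      exact (hint _).mul (hsi.pow 2)
    have h9 := hdvd _ p (T ^ 2) (-6 * T) 9 hz (by push_cast; field_simp; ring)
    have h5 : p ∣ 3 ^ 2 := by exact_mod_cast h9
    exact hp3 ((Nat.prime_dvd_prime_iff_eq hp Nat.prime_three).1 (hp.dvd_of_dvd_pow h5))
  have hmod : ¬ (t ≡ 3 [ZMOD 27] ∨ t ≡ 21 [ZMOD 27]) := by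
    intro ht
    obtain ⟨ρ, rfl, hρ⟩ : ∃ r : ℤ, t = 9 * r + 3 ∧ ¬ 3 ∣ 2 * r + 1 := by
      rw [Int.ModEq, Int.ModEq] at ht
      exact ⟨t / 9, by omega, by omega⟩
    have hΔ' : d * n ^ 3 = 27 * (3 * ρ ^ 2 + 3 * ρ + 1) := by
      rw [← hΔ, shanksDelta]; ring
    have h3T : ∀ S : K, IsIntegral ℤ S → (3 * g - T) ^ 3 = 9 * S → (3 : ℤ) ∣ T := by
      intro S hS h
      have h9 : (9 : ℤ) ∣ T ^ 3 := by
        refine dvd_of_intCast_eq_mul (L := K) (by norm_num)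
          (z := ((3 : ℤ) * g ^ 3 - (3 * T : ℤ) * g ^ 2 + (T ^ 2 : ℤ) * g) - S) ?_ ?_
        · exact ((((hint _).mul (hg.pow 3)).sub ((hint _).mul (hg.pow 2))).add
            ((hint _).mul hg)).sub hS
        · push_cast
          linear_combination -h
      exact Int.prime_three.dvd_of_dvd_pow ((by norm_num : (3 : ℤ) ∣ 9).trans h9)
    have hxi : IsIntegral ℤ (3 * g - T : K) := by
      simpa using ((hint 3).mul hg).sub (hint T)
    -- Since `v_3(d n³) = 3`, either `3 ∣ n` and `3 ∤ d`, or `3 ∤ n` and `27 ∣ d`. The first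
    -- violates a congruence, the second makes `(g - T')²/3` integral.
    by_cases h3n : 3 ∣ n
    · obtain ⟨n', rfl⟩ := h3n
      have hd3 : ¬ 3 ∣ d := by
        rintro ⟨d', rfl⟩
        have : 3 * (d' * n' ^ 3) = 3 * ρ ^ 2 + 3 * ρ + 1 := by linarith
        omega
      obtain ⟨T', rfl⟩ := h3T ((d * n' : ℤ) * (3 * g - T) + (ε * (2 * ρ + 1) * d : ℤ))
        (((hint _).mul hxi).add (hint _)) (by rw [hx]; push_cast; ring)
      have h1 : (3 : ℤ) ∣ ε * ((2 * ρ + 1) * d) := by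
        refine dvd_of_intCast_eq_mul (L := K) (by norm_num)
          (z := (g - T') ^ 3 - (d * n' : ℤ) * (g - T')) ?_ ?_
        · exact ((hg.sub (hint _)).pow 3).sub ((hint _).mul (hg.sub (hint _)))
        · push_cast at hx ⊢
          have h9 : (9 : K) ≠ 0 := by norm_num
          apply mul_left_cancel₀ h9
          linear_combination -hx
      have h2 : (3 : ℤ) ∣ (2 * ρ + 1) * d := by
        rcases hε with rfl | rfl
        · simpa using h1
        · simpa using h1
      exact (Int.prime_three.dvd_or_dvd h2).elim hρ hd3
    · have hcop : IsCoprime (3 : ℤ) n := (Int.prime_three.irreducible.coprime_iff_not_dvd).2 h3n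
      have h27 : (27 : ℤ) ∣ d :=
        ((hcop.pow (m := 3) (n := 3) : IsCoprime ((3 : ℤ) ^ 3) (n ^ 3))).dvd_of_dvd_mul_right
          ⟨_, hΔ'⟩
      obtain ⟨d', rfl⟩ := h27
      obtain ⟨T', rfl⟩ := h3T ((9 * d' * n : ℤ) * (3 * g - T) + (27 * ε * (2 * ρ + 1) * d' : ℤ))
        (((hint _).mul hxi).add (hint _)) (by rw [hx]; push_cast; ring)
      set s : K := (d' * n : ℤ) * (g - T') + (ε * (2 * ρ + 1) * d' : ℤ) with hs
      have hsi : IsIntegral ℤ s := ((hint _).mul (hg.sub (hint _))).add (hint _)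
      have hys : (g - T') ^ 3 = 9 * s := by
        rw [hs]
        push_cast at hx ⊢
        have h9 : (27 : K) ≠ 0 := by norm_num
        apply mul_left_cancel₀ h9
        linear_combination hx
      have hz : IsIntegral ℤ ((g - T') ^ 2 / 3) := by
        refine IsIntegral.of_pow (n := 3) (by norm_num) ?_
        have : ((g - T') ^ 2 / 3) ^ 3 = (3 : ℤ) * s ^ 2 := by
          rw [div_pow, ← pow_mul, mul_comm 2 3, pow_mul, hys]
          push_cast
          field_simp
          ring
        rw [this]
        exact (hint _).mul (hsi.pow 2)
      have h9 := hdvd _ 3 (T' ^ 2) (-2 * T') 1 hz (by push_cast; field_simp; ring)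
      norm_num at h9
  refine ⟨fun h => hmod (Or.inl h), fun h => hmod (Or.inr h), fun p hp hp3 hv => ?_⟩
  have : Fact p.Prime := ⟨hp⟩
  have hvd : padicValInt p d ≤ 1 := by
    by_contra hlt
    exact hsq p hp hp3 ((padicValInt_dvd_iff 2 d).2 (Or.inr (by omega)))
  have hvc : padicValInt p (shanksDelta t) = padicValInt p d + 3 * padicValInt p n := by
    rw [hΔ, padicValInt.mul hd0 (pow_ne_zero 3 hn0), padicValInt, padicValInt, padicValInt,
      Int.natAbs_pow, padicValNat.pow]
  rw [Nat.ModEq] at hv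
  omega

/-- Because `𝓞 = ℤ[γ]`, the difference `γ - σγ` divides `v - σv` for every integer `v`. Taking `v =
σγ` produces `u` with `1 + u + u σu = 0` and norm 1, hence a root of `f_t` with `t` the trace of
`u`. -/
theorem exists_shanks_of_generatesIntegers [IsGalois ℚ K] (hdeg : Module.finrank ℚ K = 3)
    {γ : 𝓞 K} (hγ : GeneratesIntegers γ) :
    ∃ (t : ℤ) (θ : K), IsShanksGenerator t θ ∧ ShanksValuationCondition t := by
  obtain ⟨σ, hσ3, hσ⟩ := exists_generator hdeg
  have hgen := adjoin_eq_top_of_generatesIntegers hγ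
  have hne := apply_ne_of_adjoin_eq_top hdeg hσ hgen
  have hadj := generatesIntegers_iff.1 hγ
  have hg : IsIntegral ℤ (γ : K) := γ.2
  set x : K := (γ : K) with hx
  have hint : ∀ m : ℤ, IsIntegral ℤ (m : K) := fun m => isIntegral_intCast m
  have hne2 : σ (σ x) ≠ σ x := fun h => hne (σ.injective h)
  have hne3 : σ (σ x) ≠ x := fun h => hne2 (by
    have := congrArg σ h
    rw [hσ3] at this
    exact h.trans this)
  have hy := isIntegral_int_algEquiv σ hg
  have hz := isIntegral_int_algEquiv σ hy
  have hZ : ∀ v : K, IsIntegral ℤ v → σ v = v → ∃ n : ℤ, v = n := fun v hv h => by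
    obtain ⟨r, hr⟩ := hσ v h
    exact exists_int_eq_of_isIntegral hv hr
  have hσσσ := hσ3 x
  obtain ⟨y, hyx⟩ : ∃ y, y = σ x := ⟨_, rfl⟩
  obtain ⟨z, hzx⟩ : ∃ z, z = σ y := ⟨_, rfl⟩
  have hzz : σ z = x := by rw [hzx, hyx, hσσσ]
  rw [← hyx] at hne hne2 hne3 hy hz
  rw [← hzx] at hne2 hne3 hz
  obtain ⟨T, hT⟩ := hZ (x + y + z) ((hg.add hy).add hz) (by
    rw [map_add, map_add, ← hyx, ← hzx, hzz]; ring)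
  obtain ⟨e2, he2⟩ := hZ (x * y + y * z + z * x)
    (((hg.mul hy).add (hy.mul hz)).add (hz.mul hg)) (by
    simp only [map_add, map_mul]; rw [← hyx, ← hzx, hzz]; ring)
  obtain ⟨e3, he3⟩ := hZ (x * y * z) ((hg.mul hy).mul hz) (by
    simp only [map_mul]; rw [← hyx, ← hzx, hzz]; ring)
  obtain ⟨d, hd⟩ := hZ ((x - y) * (y - z) * (z - x))
    (((hg.sub hy).mul (hy.sub hz)).mul (hz.sub hg)) (by
    simp only [map_mul, map_sub]; rw [← hyx, ← hzx, hzz]; ring)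
  have hcubic : x ^ 3 + ((-T : ℤ) : K) * x ^ 2 + (e2 : K) * x + ((-e3 : ℤ) : K) = 0 := by
    push_cast; rw [← hT, ← he2, ← he3]; ring
  have hcoef : ∀ v : K, IsIntegral ℤ v → ∃ A B C : ℤ, v = A + B * x + C * x ^ 2 := fun v hv =>
    exists_coeffs_of_mem_adjoin hcubic (hadj v hv)
  have hdiff : ∀ v : K, IsIntegral ℤ v → ∃ u : K, IsIntegral ℤ u ∧ v - σ v = (x - y) * u := by
    intro v hv
    obtain ⟨A, B, C, rfl⟩ := hcoef v hv
    refine ⟨B + C * (x + y), (hint B).add ((hint C).mul (hg.add hy)), ?_⟩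
    simp only [map_add, map_mul, map_pow, map_intCast, ← hyx]
    ring
  have hxy : x - y ≠ 0 := sub_ne_zero.2 (Ne.symm hne)
  have hyz : y - z ≠ 0 := sub_ne_zero.2 (Ne.symm hne2)
  have hzx' : z - x ≠ 0 := sub_ne_zero.2 hne3
  obtain ⟨u, hu, huv⟩ := hdiff y hy
  rw [← hzx] at huv
  have hu1 : (y - z) * σ u = z - x := by
    have := congrArg σ huv
    simp only [map_sub, map_mul] at this
    rw [← hyx, ← hzx, hzz] at this
    exact this.symm
  have hu2 : (z - x) * σ (σ u) = x - y := by
    have := congrArg σ hu1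
    simp only [map_sub, map_mul] at this
    rw [← hyx, ← hzx, hzz] at this
    exact this
  have hui := isIntegral_int_algEquiv σ hu
  have huii := isIntegral_int_algEquiv σ hui
  obtain ⟨t, ht⟩ := hZ (u + σ u + σ (σ u)) ((hu.add hui).add huii) (by
    rw [map_add, map_add, hσ3]; ring)
  have hr1 : 1 + u + u * σ u = 0 := by
    apply mul_left_cancel₀ hxy
    linear_combination -(1 + σ u) * huv + hu1
  have hr2 : 1 + σ u + σ u * σ (σ u) = 0 := by
    have := congrArg σ hr1
    simpa only [map_add, map_mul, map_one, map_zero] using this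
  have hr3 : u * σ u * σ (σ u) = 1 := by
    linear_combination u * hr2 - hr1
  have hroot : aeval u (shanksPoly t) = 0 := by
    rw [aeval_shanksPoly, ← ht]
    have hr4 : 1 + σ (σ u) + σ (σ u) * u = 0 := by
      have := congrArg σ hr2
      simpa only [map_add, map_mul, map_one, map_zero, hσ3] using this
    linear_combination hr3 - u * hr1 - u * hr2 - u * hr4
  have hugen : IsShanksGenerator t u := by
    refine ⟨hroot, adjoin_eq_top_of_forall_ne hdeg ?_⟩
    intro r hr
    have hσu : σ u = u := by rw [hr, AlgEquiv.commutes]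
    rw [hσu, hr] at hr1
    have h1 : algebraMap ℚ K (1 + r + r * r) = algebraMap ℚ K 0 := by
      simpa only [map_add, map_mul, map_one, map_zero] using hr1
    have h2 := (algebraMap ℚ K).injective h1
    nlinarith [sq_nonneg (2 * r + 1)]
  refine ⟨t, u, hugen, ?_⟩
  have hd0 : d ≠ 0 := by
    rintro rfl
    simp only [Int.cast_zero, mul_eq_zero] at hd
    tauto
  -- `Δ d² = q³`
  have htd : (t : K) * d = (y - z) ^ 2 * (z - x) + (z - x) ^ 2 * (x - y) + (x - y) ^ 2 * (y - z) := by
    rw [← hd, ← ht]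
    linear_combination -(y - z) * (z - x) * huv + (z - x) * (x - y) * hu1 + (x - y) * (y - z) * hu2
  have hΔd : shanksDelta t * d ^ 2 = (T ^ 2 - 3 * e2) ^ 3 := by
    have : ((shanksDelta t * d ^ 2 : ℤ) : K) = (((T ^ 2 - 3 * e2) ^ 3 : ℤ) : K) := by
      rw [shanksDelta]
      push_cast
      have e : ((t : K) ^ 2 + 3 * t + 9) * d ^ 2 = (t * d) ^ 2 + 3 * (t * d) * d + 9 * d ^ 2 := by ring
      rw [e, htd, ← hd, ← hT, ← he2]
      ring
    exact_mod_cast this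
  -- Applying the divisibility to `u` itself gives `Δ = ± d N(v)`, so `d ∣ Δ`; with `Δ d² = (T² -
  -- 3e₂)³` this yields `d ∣ T² - 3e₂`.
  obtain ⟨v, hv, hvu⟩ := hdiff u hu
  have hv1 := isIntegral_int_algEquiv σ hv
  have hv2 := isIntegral_int_algEquiv σ hv1
  obtain ⟨W, hW⟩ := hZ (v * σ v * σ (σ v)) ((hv.mul hv1).mul hv2) (by
    rw [map_mul, map_mul, hσ3]; ring)
  have hdW : shanksDelta t ^ 2 = (d * W) ^ 2 := by
    have h1 := prod_sub_sq_eq hσ3 hroot (apply_ne_of_adjoin_eq_top hdeg hσ hugen.2)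
    have h2 : σ u - σ (σ u) = (y - z) * σ v := by
      have := congrArg σ hvu
      simpa only [map_sub, map_mul, ← hyx, ← hzx] using this
    have h3 : σ (σ u) - u = (z - x) * σ (σ v) := by
      have := congrArg σ h2
      simpa only [map_sub, map_mul, ← hyx, ← hzx, hzz, hσ3] using this
    rw [hvu, h2, h3] at h1
    have : ((shanksDelta t ^ 2 : ℤ) : K) = (((d * W) ^ 2 : ℤ) : K) := by
      push_cast
      rw [← h1, ← hd, ← hW]
      ring
    exact_mod_cast this
  have hdΔ : d ∣ shanksDelta t := by
    rw [← Int.pow_dvd_pow_iff two_ne_zero, hdW, mul_pow]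
    exact Dvd.intro _ rfl
  obtain ⟨w, hw⟩ := hdΔ
  have hdq : d ∣ T ^ 2 - 3 * e2 := by
    rw [← Int.pow_dvd_pow_iff three_ne_zero, ← hΔd, hw]
    exact ⟨w, by ring⟩
  obtain ⟨n, hn⟩ := hdq
  have hΔn : shanksDelta t = d * n ^ 3 := by
    rw [hn] at hΔd
    apply mul_right_cancel₀ (pow_ne_zero 2 hd0)
    rw [hΔd]; ring
  -- `r = ± (2 t + 3) d`
  set r : ℤ := 2 * T ^ 3 - 9 * T * e2 + 27 * e3 with hr
  have hr2 : r ^ 2 = ((2 * t + 3) * d) ^ 2 := by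
    -- This is the discriminant of a cubic in terms of its two covariant constants; compare with `4Δ
    -- = (2t+3)² + 27` multiplied by `d²`.
    have h1 : 4 * (T ^ 2 - 3 * e2) ^ 3 - r ^ 2 = 27 * d ^ 2 := by
      have : ((4 * (T ^ 2 - 3 * e2) ^ 3 - r ^ 2 : ℤ) : K) = ((27 * d ^ 2 : ℤ) : K) := by
        rw [hr]
        push_cast
        rw [← hd, ← hT, ← he2, ← he3]
        ring
      exact_mod_cast this
    have h2 := four_mul_shanksDelta t
    rw [← hΔd] at h1
    linear_combination d ^ 2 * h2 - h1
  obtain ⟨ε, hε, hrε⟩ : ∃ ε : ℤ, (ε = 1 ∨ ε = -1) ∧ r = ε * (2 * t + 3) * d := by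
    rcases sq_eq_sq_iff_eq_or_eq_neg.1 hr2 with h | h
    · exact ⟨1, Or.inl rfl, by rw [h]; ring⟩
    · exact ⟨-1, Or.inr rfl, by rw [h]; ring⟩
  refine shanksValuationCondition_of_cubic (g := x) (T := T) hε hg hΔn ?_ ?_
  · have h1 : (3 * x - T) ^ 3 = 3 * ((T ^ 2 - 3 * e2 : ℤ) : K) * (3 * x - T) + (r : ℤ) := by
      rw [hr]
      push_cast at hcubic ⊢
      linear_combination 27 * hcubic
    rw [h1, hn, hrε]
    push_cast
    ring
  · intro v' N a b c hv' h
    obtain ⟨A, B, C, rfl⟩ := hcoef v' hv'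
    -- Differencing this relation and its conjugates twice isolates the coefficient of `x²`.
    have f0 : ((a - N * A : ℤ) : K) + ((b - N * B : ℤ) : K) * x + ((c - N * C : ℤ) : K) * x ^ 2 = 0 := by
      push_cast; linear_combination -h
    have f1 := congrArg σ f0
    simp only [map_add, map_mul, map_pow, map_intCast, map_zero, ← hyx] at f1
    have f2 := congrArg σ f1
    simp only [map_add, map_mul, map_pow, map_intCast, map_zero, ← hzx] at f2
    have g1 : ((b - N * B : ℤ) : K) + ((c - N * C : ℤ) : K) * (x + y) = 0 := by
      apply mul_left_cancel₀ hxy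
      linear_combination f0 - f1
    have g2 : ((b - N * B : ℤ) : K) + ((c - N * C : ℤ) : K) * (y + z) = 0 := by
      apply mul_left_cancel₀ hyz
      linear_combination f1 - f2
    have g3 : ((c - N * C : ℤ) : K) = 0 := by
      apply mul_left_cancel₀ hzx'
      linear_combination g2 - g1
    have g4 : c - N * C = 0 := by exact_mod_cast g3
    exact ⟨C, by linarith⟩

end PowerBasis

/-! ### Assembly of the theorem -/

lemma three_dvd_of_deltaQuotientIsCubeOf {K : Type*} [Field K] [NumberField K] {t : ℤ} {n : ℕ}
    (hn : DeltaQuotientIsCubeOf K t n) (h : 3 ∣ n) : (3 : ℤ) ∣ t := by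
  obtain ⟨m, rfl⟩ := h
  rw [DeltaQuotientIsCubeOf, shanksDelta] at hn
  refine Int.prime_three.dvd_of_dvd_pow (n := 2)
    ⟨9 * (abelianConductor K * m ^ 3) - t - 3, ?_⟩
  push_cast at hn
  linear_combination hn

theorem theorem1 (K : Type*) [Field K] [NumberField K] [IsGalois ℚ K]
    [IsCyclic (K ≃ₐ[ℚ] K)] (hdeg : Module.finrank ℚ K = 3) :
    [HasPowerIntegralBasis K,
      ∃ t : ℤ, -1 ≤ t ∧ IsSimplestCubic K t ∧ ∃ n : ℕ, DeltaQuotientIsCubeOf K t n,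
      ∃ t : ℤ, -1 ≤ t ∧ IsSimplestCubic K t ∧ ShanksValuationCondition t].TFAE ∧
    ∀ (t : ℤ) (θ : K), -1 ≤ t → IsShanksGenerator t θ →
      ((∃ n : ℕ, DeltaQuotientIsCubeOf K t n) ∨ ShanksValuationCondition t) →
      ∃ n : ℕ, 0 < n ∧ DeltaQuotientIsCubeOf K t n ∧ (3 ∣ n → 3 ∣ t) ∧
        (∃ a : ℤ, CongruentToThird t n a) ∧
        ∀ a : ℤ, CongruentToThird t n a →
          ∃ γ : 𝓞 K, (γ : K) = (θ - (a : K)) / (n : K) ∧ GeneratesIntegers γ := by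
  have h32 : ∀ t : ℤ, IsSimplestCubic K t → ShanksValuationCondition t →
      ∃ n : ℕ, 0 < n ∧ DeltaQuotientIsCubeOf K t n := fun t ⟨θ, hθ⟩ hval =>
    exists_deltaQuotientIsCubeOf hdeg hθ hval
  refine ⟨?_, ?_⟩
  · tfae_have 1 → 3 := by
      rintro ⟨γ, hγ⟩
      obtain ⟨t, θ, hθ, hval⟩ := exists_shanks_of_generatesIntegers hdeg hγ
      rcases le_or_gt (-1) t with ht | ht
      · exact ⟨t, ht, ⟨θ, hθ⟩, hval⟩
      · exact ⟨-3 - t, by omega, ⟨θ⁻¹, hθ.inv⟩, hval.neg_three_sub⟩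
    tfae_have 3 → 2 := by
      rintro ⟨t, ht, hK, hval⟩
      obtain ⟨n, -, hn⟩ := h32 t hK hval
      exact ⟨t, ht, hK, n, hn⟩
    tfae_have 2 → 3 := by
      rintro ⟨t, ht, ⟨θ, hθ⟩, n, hn⟩
      exact ⟨t, ht, ⟨θ, hθ⟩, shanksValuationCondition_of_deltaQuotientIsCubeOf hdeg hθ hn⟩
    tfae_have 3 → 1 := by
      rintro ⟨t, -, ⟨θ, hθ⟩, hval⟩
      obtain ⟨n, hn0, hn⟩ := exists_deltaQuotientIsCubeOf hdeg hθ hval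
      obtain ⟨a, ha⟩ := exists_congruentToThird (three_dvd_of_deltaQuotientIsCubeOf hn)
      obtain ⟨γ, -, hγ⟩ := exists_generatesIntegers hdeg hθ hval hn0.ne' hn ha
      exact ⟨γ, hγ⟩
    tfae_finish
  · intro t θ _ hθ h
    have hval : ShanksValuationCondition t := h.elim
      (fun ⟨_, hn⟩ => shanksValuationCondition_of_deltaQuotientIsCubeOf hdeg hθ hn) id
    obtain ⟨n, hn0, hn⟩ := exists_deltaQuotientIsCubeOf hdeg hθ hval
    have h3 := three_dvd_of_deltaQuotientIsCubeOf hn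
    exact ⟨n, hn0, hn, h3, exists_congruentToThird h3,
      fun a ha => exists_generatesIntegers hdeg hθ hval hn0.ne' hn ha⟩
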